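/- Let $\Bbbk$ be an algebraically closed field of characteristic zero. For $n\ge 0$ let $S_n$ be the symmetric group on $\{1,\dots,n\}$ and, for a partition $\lambda\vdash n$, let $\mathbf S^\lambda$ be the corresponding Specht module over $\Bbbk[S_n]$. For $\beta,\delta,\epsilon\vdash b$ let $\mathbf g_{\beta,\delta}^{\epsilon}$ be the Kronecker coefficient, that is, the multiplicity of $\mathbf S^\epsilon$ in $\mathbf S^\beta\otimes_\Bbbk\mathbf S^\delta$ with the diagonal action of $S_b$. For $\alpha\vdash p$, $\beta\vdash q$ and $\lambda\vdash p+q$ let $\mathbf c_{\alpha,\beta}^{\lambda}$ be the Littlewood–Richardson coefficient, that is, the multiplicity of $\mathbf S^\lambda$ in $\mathrm{Ind}_{S_p\times S_q}^{S_{p+q}}(\mathbf S^\alpha\otimes_\Bbbk\mathbf S^\beta)$, where $S_p$ permutes the first $p$ and $S_q$ the last $q$ elements. Let $IS_n$ be the symmetric inverse semigroup of all bijections between subsets of $\{1,\dots,n\}$. For $k\le n$ let $\mathbf L_k$ be the set of elements of $IS_n$ with domain $\{1,\dots,k\}$, and let $\Bbbk[\mathbf L_k]$ be the $\Bbbk[IS_n]$-$\Bbbk[S_k]$-bimodule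 with basis $\mathbf L_k$ on which $\sigma\in IS_n$ acts by $\sigma\cdot\pi=\sigma\pi$ if $\sigma\pi\in\mathbf L_k$ and $\sigma\cdot\pi=0$ otherwise, while $S_k$ (identified with the group of those elements of $IS_n$ whose domain and codomain are both $\{1,\dots,k\}$) acts by right multiplication. For $\lambda\vdash k$ let $\mathbf N^\lambda=\Bbbk[\mathbf L_k]\otimes_{\Bbbk[S_k]}\mathbf S^\lambda$; up to isomorphism, these are the simple $\Bbbk[IS_n]$-modules. Let $n\ge 0$, let $k,l,m\le n$, and let $\lambda\vdash k$, $\mu\vdash l$, $\nu\vdash m$. Let $\mathbf k_{\lambda,\mu}^{\nu}$ be the multiplicity of $\mathbf N^\nu$ as a composition factor of $\mathbf N^\lambda\otimes_\Bbbk\mathbf N^\mu$, on which each $\sigma\in IS_n$ acts by $\sigma\otimes\sigma$. Then: (a) If $m<\max\{k,l\}$ or $m>k+l$, then $\mathbf k_{\lambda,\mu}^{\nu}=0$. (b) If $\max\{k,l\}\le m\le k+l$, set $b:=k+l-m$, $a:=k-b$ and $c:=l-b$. Then $$\mathbf k_{\lambda,\mu}^{\nu}=\sum_{\alpha\vdash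 a}\sum_{\beta\vdash b}\sum_{\gamma\vdash c}\sum_{\delta\vdash b}\sum_{\epsilon\vdash b}\sum_{\kappa\vdash a+b}\mathbf c_{\alpha,\beta}^{\lambda}\,\mathbf c_{\gamma,\delta}^{\mu}\,\mathbf g_{\beta,\delta}^{\epsilon}\,\mathbf c_{\alpha,\epsilon}^{\kappa}\,\mathbf c_{\kappa,\gamma}^{\nu}.$$ -/

import Mathlib

open scoped TensorProduct

noncomputable section

namespace ISKron

/-! ### Multiplicities -/

/-- The Jordan-Hölder multiplicity `[M : N]` of `N` in `M`: the number of factors isomorphic to `N`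
in a composition series `⊥ = M₀ ⋖ M₁ ⋖ ⋯ ⋖ M_r = ⊤` of `M`. By the Jordan-Hölder theorem the set
below has at most one element. -/
def compositionMultiplicity (A : Type*) [Ring A] (N M : Type*) [AddCommGroup N] [Module A N]
    [AddCommGroup M] [Module A M] : ℕ :=
  sInf {c : ℕ | ∃ s : CompositionSeries (Submodule A M), s.head = ⊥ ∧ s.last = ⊤ ∧
    c = Nat.card {i : Fin s.length //
      Nonempty ((s i.succ ⧸ (s i.castSucc).submoduleOf (s i.succ)) ≃ₗ[A] N)}}

/-- The multiplicity of a representation `σ` of a monoid `G` in a representation `ρ`, both viewed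
as modules over the monoid algebra. -/
def multiplicity {𝕜 G W V : Type*} [Field 𝕜] [Monoid G] [AddCommGroup W] [Module 𝕜 W]
    [AddCommGroup V] [Module 𝕜 V] (σ : Representation 𝕜 G W) (ρ : Representation 𝕜 G V) : ℕ :=
  compositionMultiplicity (MonoidAlgebra 𝕜 G) σ.asModule ρ.asModule

/-! ### Specht modules -/

/-- The Young diagram of a partition; the cell `(i, j)` lies in row `i` and column `j`. -/
def diagram {n : ℕ} (lam : n.Partition) : YoungDiagram :=
  YoungDiagram.ofRowLens (lam.parts.sort (· ≥ ·)) (Multiset.pairwise_sort _ _).sortedGE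

/-- Tableaux of shape `lam`, with entries `Fin n`, each used once. -/
abbrev Tableau {n : ℕ} (lam : n.Partition) : Type := {c : ℕ × ℕ // c ∈ diagram lam} ≃ Fin n

/-- The row of the tableau in which an entry stands. -/
def Tableau.row {n : ℕ} {lam : n.Partition} (T : Tableau lam) (x : Fin n) : ℕ := (T.symm x).1.1

/-- The column of the tableau in which an entry stands. -/
def Tableau.col {n : ℕ} {lam : n.Partition} (T : Tableau lam) (x : Fin n) : ℕ := (T.symm x).1.2

/-- Tabloids, that is, tableaux up to permutations inside the rows. A tabloid is given by the
function sending each entry to the row that contains it. -/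
abbrev Tabloid {n : ℕ} (lam : n.Partition) : Type :=
  {t : Fin n → ℕ // ∃ T : Tableau lam, t = T.row}

/-- The tabloid of a tableau. -/
def Tableau.tabloid {n : ℕ} {lam : n.Partition} (T : Tableau lam) : Tabloid lam := ⟨T.row, T, rfl⟩

/-- The action of a permutation on tableaux: it is applied to all entries. -/
def Tableau.act {n : ℕ} {lam : n.Partition} (g : Equiv.Perm (Fin n)) (T : Tableau lam) :
    Tableau lam := T.trans g

/-- The action of a permutation on tabloids: it is applied to all entries. -/
def Tabloid.act {n : ℕ} {lam : n.Partition} (g : Equiv.Perm (Fin n)) (t : Tabloid lam) :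
    Tabloid lam :=
  ⟨fun x => t.1 (g⁻¹ x), by
    obtain ⟨t, T, rfl⟩ := t
    exact ⟨T.act g, rfl⟩⟩

theorem Tableau.tabloid_act {n : ℕ} {lam : n.Partition} (g : Equiv.Perm (Fin n))
    (T : Tableau lam) : (T.act g).tabloid = Tabloid.act g T.tabloid := rfl

/-- The permutation module on the tabloids of shape `lam`. -/
def tabloidRep (𝕜 : Type*) [Field 𝕜] {n : ℕ} (lam : n.Partition) :
    Representation 𝕜 (Equiv.Perm (Fin n)) (Tabloid lam →₀ 𝕜) where
  toFun g := Finsupp.lmapDomain 𝕜 𝕜 (Tabloid.act g)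
  map_one' := by
    ext t : 2
    simp [Tabloid.act]
  map_mul' g h := by
    ext t : 2
    simp [Tabloid.act]

/-- The polytabloid of a tableau `T`: the signed sum of the tabloids of `π T`, where `π` runs over
the column stabilizer of `T`. -/
def polytabloid (𝕜 : Type*) [Field 𝕜] {n : ℕ} {lam : n.Partition} (T : Tableau lam) :
    Tabloid lam →₀ 𝕜 :=
  ∑ π : Equiv.Perm (Fin n) with ∀ x, T.col (π x) = T.col x,
    Finsupp.single (T.act π).tabloid ((Equiv.Perm.sign π : ℤ) : 𝕜)

theorem tabloidRep_polytabloid (𝕜 : Type*) [Field 𝕜] {n : ℕ} {lam : n.Partition}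
    (g : Equiv.Perm (Fin n)) (T : Tableau lam) :
    tabloidRep 𝕜 lam g (polytabloid 𝕜 T) = polytabloid 𝕜 (T.act g) := by
  unfold polytabloid
  rw [map_sum]
  refine Finset.sum_equiv (MulAut.conj g).toEquiv ?_ ?_
  · intro π
    simp only [Finset.mem_filter, Finset.mem_univ, true_and]
    have key : ∀ y, (T.act g).col y = T.col (g⁻¹ y) := fun y => rfl
    constructor
    · intro h x
      rw [key, key]
      simpa using h (g⁻¹ x)
    · intro h x
      have := h (g x)
      rw [key, key] at this
      simpa using this
  · intro π _
    have : ((T.act g).act (MulAut.conj g π)).tabloid = Tabloid.act g (T.act π).tabloid := by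
      rw [← Tableau.tabloid_act]
      congr 1
      ext c
      simp [Tableau.act]
    simp only [tabloidRep, MonoidHom.coe_mk, OneHom.coe_mk, Finsupp.lmapDomain_apply,
      Finsupp.mapDomain_single]
    erw [this]
    have hs : Equiv.Perm.sign (MulAut.conj g π) = Equiv.Perm.sign π := by
      rw [MulAut.conj_apply, map_mul, map_mul, map_inv]
      exact mul_inv_cancel_comm _ _
    erw [hs]

/-- The Specht module as a subrepresentation: the span of all polytabloids. -/
def spechtSub (𝕜 : Type*) [Field 𝕜] {n : ℕ} (lam : n.Partition) :
    Subrepresentation (tabloidRep 𝕜 lam) where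
  toSubmodule := Submodule.span 𝕜 (Set.range fun T : Tableau lam => polytabloid 𝕜 T)
  apply_mem_toSubmodule g v hv := by
    induction hv using Submodule.span_induction with
    | mem x hx =>
      obtain ⟨T, rfl⟩ := hx
      exact Submodule.subset_span ⟨T.act g, (tabloidRep_polytabloid 𝕜 g T).symm⟩
    | zero => simp
    | add x y _ _ hx hy => rw [map_add]; exact Submodule.add_mem _ hx hy
    | smul a x _ hx => rw [map_smul]; exact Submodule.smul_mem _ a hx

/-- The underlying space of the Specht module `S^lam`. -/
def SpechtV (𝕜 : Type*) [Field 𝕜] {n : ℕ} (lam : n.Partition) : Type _ :=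
  (spechtSub 𝕜 lam).toSubmodule

instance (𝕜 : Type*) [Field 𝕜] {n : ℕ} (lam : n.Partition) : AddCommGroup (SpechtV 𝕜 lam) :=
  inferInstanceAs (AddCommGroup (spechtSub 𝕜 lam).toSubmodule)

instance (𝕜 : Type*) [Field 𝕜] {n : ℕ} (lam : n.Partition) : Module 𝕜 (SpechtV 𝕜 lam) :=
  inferInstanceAs (Module 𝕜 (spechtSub 𝕜 lam).toSubmodule)

/-- The Specht module `S^lam`, a representation of the symmetric group on `Fin n`. -/
def specht (𝕜 : Type*) [Field 𝕜] {n : ℕ} (lam : n.Partition) :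
    Representation 𝕜 (Equiv.Perm (Fin n)) (SpechtV 𝕜 lam) :=
  (spechtSub 𝕜 lam).toRepresentation

/-! ### Classical Kronecker and Littlewood-Richardson coefficients -/

/-- The Kronecker coefficient `g_{lam, mu}^nu`: the multiplicity of `S^nu` in `S^lam ⊗ S^mu` with
the diagonal action. -/
def kroneckerCoeff (𝕜 : Type*) [Field 𝕜] {n : ℕ} (lam mu nu : n.Partition) : ℕ :=
  multiplicity (specht 𝕜 nu) ((specht 𝕜 lam).tprod (specht 𝕜 mu))

/-- For `p + q = n`, the embedding of `S_p × S_q` into `S_n`: the first factor permutes the first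
`p` elements, the second one permutes the last `q` elements. -/
def youngEmb {p q n : ℕ} (h : p + q = n) :
    Equiv.Perm (Fin p) × Equiv.Perm (Fin q) →* Equiv.Perm (Fin n) :=
  (finSumFinEquiv.trans (finCongr h)).permCongrHom.toMonoidHom.comp
    (Equiv.Perm.sumCongrHom (Fin p) (Fin q))

/-- The outer tensor product `S^lam ⊗ S^mu`, a representation of `S_p × S_q`. -/
def outerTensor (𝕜 : Type*) [Field 𝕜] {p q : ℕ} (lam : p.Partition) (mu : q.Partition) :
    Representation 𝕜 (Equiv.Perm (Fin p) × Equiv.Perm (Fin q))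
      (SpechtV 𝕜 lam ⊗[𝕜] SpechtV 𝕜 mu) :=
  Representation.tprod ((specht 𝕜 lam).comp (MonoidHom.fst _ _))
    ((specht 𝕜 mu).comp (MonoidHom.snd _ _))

/-- The Littlewood-Richardson coefficient `c_{lam, mu}^nu`: the multiplicity of `S^nu` in the
representation of `S_n` induced from the representation `S^lam ⊗ S^mu` of `S_p × S_q`. -/
def lrCoeff (𝕜 : Type*) [Field 𝕜] {p q n : ℕ} (h : p + q = n) (lam : p.Partition)
    (mu : q.Partition) (nu : n.Partition) : ℕ :=
  multiplicity (specht 𝕜 nu) (Representation.ind (youngEmb h) (outerTensor 𝕜 lam mu))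

/-! ### The symmetric inverse semigroup -/

/-- The symmetric inverse semigroup `IS_n` of all bijections between subsets of `Fin n`. -/
def IS (n : ℕ) : Type := Fin n ≃. Fin n

/-- Composition is from right to left. -/
instance (n : ℕ) : Monoid (IS n) where
  mul f g := PEquiv.trans g f
  one := PEquiv.refl (Fin n)
  mul_assoc f g h := (PEquiv.trans_assoc h g f).symm
  one_mul f := PEquiv.trans_refl f
  mul_one f := PEquiv.refl_trans f

/-- The domain of a partial bijection. -/
def IS.dom {n : ℕ} (f : IS n) : Set (Fin n) := {x | (PEquiv.toFun f x).isSome}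

theorem IS.mul_toFun {n : ℕ} (f g : IS n) (x : Fin n) :
    PEquiv.toFun (f * g) x = (PEquiv.toFun g x).bind (PEquiv.toFun f) := rfl

theorem IS.dom_mul_subset {n : ℕ} (f g : IS n) : (f * g).dom ⊆ g.dom := by
  intro x hx
  simp only [IS.dom, Set.mem_ofPred_eq, IS.mul_toFun] at hx ⊢
  cases h : PEquiv.toFun g x with
  | none => simp [h] at hx
  | some y => rfl

/-- The left cell of the idempotent `ε_X` with `X` the set of the first `k` elements: all partial
bijections with domain `X`. -/
abbrev Cell (n k : ℕ) : Type := {p : IS n // p.dom = {x : Fin n | x.val < k}}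

open Classical in
/-- The product `σ p` if it stays in the left cell, and `0` otherwise. -/
def cellAct (𝕜 : Type*) [Field 𝕜] {n k : ℕ} (σ : IS n) (p : Cell n k) : Cell n k →₀ 𝕜 :=
  if h : (σ * p.1).dom = {x : Fin n | x.val < k} then Finsupp.single ⟨σ * p.1, h⟩ 1 else 0

/-- The cell module `𝕜[L]` over `IS_n`. -/
def cellRep (𝕜 : Type*) [Field 𝕜] (n k : ℕ) : Representation 𝕜 (IS n) (Cell n k →₀ 𝕜) where
  toFun σ := Finsupp.linearCombination 𝕜 (cellAct 𝕜 σ)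
  map_one' := by
    ext p : 2
    have h : (1 * p.1).dom = {x : Fin n | x.val < k} := by rw [one_mul]; exact p.2
    simp [cellAct, p.2]
  map_mul' σ τ := by
    ext p : 2
    by_cases h : (τ * p.1).dom = {x : Fin n | x.val < k}
    · simp [cellAct, h, mul_assoc]
    · have h' : ¬ (σ * (τ * p.1)).dom = {x : Fin n | x.val < k} := by
        intro h'
        apply h
        apply Set.Subset.antisymm
        · exact (IS.dom_mul_subset _ _).trans p.2.le
        · exact h'.ge.trans (IS.dom_mul_subset _ _)
      simp [cellAct, h, h', mul_assoc]

/-- For `k ≤ n`, the identification of `S_k` with the maximal subgroup of `IS_n` at `ε_X`, where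
`X` is the set of the first `k` elements. -/
def groupElt {n k : ℕ} (h : k ≤ n) (g : Equiv.Perm (Fin k)) : IS n where
  toFun x := if hx : x.val < k then some (Fin.castLE h (g ⟨x, hx⟩)) else none
  invFun x := if hx : x.val < k then some (Fin.castLE h (g⁻¹ ⟨x, hx⟩)) else none
  inv x y := by
    by_cases hx : x.val < k <;> by_cases hy : y.val < k
    · simp only [hx, hy, dite_true, Option.some.injEq]
      constructor
      · rintro rfl
        ext; simp
      · rintro rfl
        ext; simp
    · simp only [hx, hy, dite_true, dite_false, Option.some.injEq]
      constructor
      · intro h'; simp at h'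
      · rintro rfl; simp at hy
    · simp only [hx, hy, dite_true, dite_false, Option.some.injEq]
      constructor
      · rintro rfl; simp at hx
      · intro h'; simp at h'
    · simp [hx, hy]

theorem groupElt_mul {n k : ℕ} (h : k ≤ n) (g g' : Equiv.Perm (Fin k)) :
    groupElt h (g * g') = groupElt h g * groupElt h g' := by
  refine PEquiv.ext fun x => ?_
  change PEquiv.toFun _ x = PEquiv.toFun _ x
  rw [IS.mul_toFun]
  by_cases hx : x.val < k <;> simp [groupElt, hx]

theorem mul_groupElt_one {n k : ℕ} (h : k ≤ n) (p : Cell n k) : p.1 * groupElt h 1 = p.1 := by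
  refine PEquiv.ext fun x => ?_
  change PEquiv.toFun _ x = PEquiv.toFun _ x
  rw [IS.mul_toFun]
  by_cases hx : x.val < k
  · simp [groupElt, hx]
  · have : x ∉ p.1.dom := by rw [p.2]; exact hx
    simp only [IS.dom, Set.mem_ofPred_eq, Option.not_isSome_iff_eq_none] at this
    simp [groupElt, hx, this]

theorem dom_mul_groupElt {n k : ℕ} (h : k ≤ n) (f : IS n) (g : Equiv.Perm (Fin k)) :
    (f * groupElt h g).dom = {x : Fin n | x.val < k} ↔ {x : Fin n | x.val < k} ⊆ f.dom := by
  have key : ∀ x : Fin n, ∀ hx : x.val < k,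
      x ∈ (f * groupElt h g).dom ↔ Fin.castLE h (g ⟨x, hx⟩) ∈ f.dom := by
    intro x hx
    simp only [IS.dom, Set.mem_ofPred_eq, IS.mul_toFun]
    simp [groupElt, hx]
  have key' : ∀ x : Fin n, ¬ x.val < k → x ∉ (f * groupElt h g).dom := by
    intro x hx
    simp only [IS.dom, Set.mem_ofPred_eq, IS.mul_toFun]
    simp [groupElt, hx]
  constructor
  · intro H x hx
    have hx' : x.val < k := hx
    have := (key (Fin.castLE h (g⁻¹ ⟨x, hx'⟩)) (by simp)).1 (by rw [H]; simp)
    simpa using this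
  · intro H
    ext x
    by_cases hx : x.val < k
    · rw [key x hx]
      exact ⟨fun _ => hx, fun _ => H (by simp)⟩
    · exact ⟨fun hx' => absurd hx' (key' x hx), fun hx' => absurd hx' hx⟩

/-- The right action of `S_k` on the left cell. -/
def Cell.rmul {n k : ℕ} (h : k ≤ n) (p : Cell n k) (g : Equiv.Perm (Fin k)) : Cell n k :=
  ⟨p.1 * groupElt h g, (dom_mul_groupElt h p.1 g).2 p.2.ge⟩

/-- The right action of `S_k` on `𝕜[L]`, written as a left action by `g ↦ (p ↦ p g⁻¹)`. -/
def cellRightRep (𝕜 : Type*) [Field 𝕜] {n k : ℕ} (h : k ≤ n) :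
    Representation 𝕜 (Equiv.Perm (Fin k)) (Cell n k →₀ 𝕜) where
  toFun g := Finsupp.lmapDomain 𝕜 𝕜 fun p => p.rmul h g⁻¹
  map_one' := by
    ext p : 2
    simp [Cell.rmul, mul_groupElt_one]
  map_mul' g g' := by
    ext p : 2
    simp [Cell.rmul, groupElt_mul, mul_assoc]

theorem cellRep_comm (𝕜 : Type*) [Field 𝕜] {n k : ℕ} (h : k ≤ n) (σ : IS n)
    (g : Equiv.Perm (Fin k)) :
    cellRep 𝕜 n k σ ∘ₗ cellRightRep 𝕜 h g = cellRightRep 𝕜 h g ∘ₗ cellRep 𝕜 n k σ := by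
  ext p : 2
  have hiff : (σ * (p.1 * groupElt h g⁻¹)).dom = {x : Fin n | x.val < k} ↔
      (σ * p.1).dom = {x : Fin n | x.val < k} := by
    rw [← mul_assoc, dom_mul_groupElt]
    exact ⟨fun H => ((IS.dom_mul_subset _ _).trans p.2.le).antisymm H, fun H => H.ge⟩
  by_cases hp : (σ * p.1).dom = {x : Fin n | x.val < k}
  · simp [cellRep, cellRightRep, cellAct, Cell.rmul, hiff, hp, mul_assoc]
  · simp [cellRep, cellRightRep, cellAct, Cell.rmul, hiff, hp]

/-- The underlying space of `N^lam = 𝕜[L] ⊗_{𝕜[S_k]} S^lam`: the tensor product over `𝕜`, modulo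
the relations `p g ⊗ v = p ⊗ g v`. -/
abbrev NV (𝕜 : Type*) [Field 𝕜] {n k : ℕ} (h : k ≤ n) (lam : k.Partition) : Type _ :=
  Representation.Coinvariants (V := (Cell n k →₀ 𝕜) ⊗[𝕜] SpechtV 𝕜 lam)
    ((cellRightRep 𝕜 h).tprod (specht 𝕜 lam))

/-- The simple `𝕜[IS_n]`-module `N^lam = 𝕜[L] ⊗_{𝕜[S_k]} S^lam`, with `IS_n` acting on `𝕜[L]`. -/
def N (𝕜 : Type*) [Field 𝕜] {n k : ℕ} (h : k ≤ n) (lam : k.Partition) :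
    Representation 𝕜 (IS n) (NV 𝕜 h lam) where
  toFun σ := Representation.Coinvariants.map _ _
    ⟨(cellRep 𝕜 n k σ).rTensor (SpechtV 𝕜 lam), fun g => by
      refine TensorProduct.ext' fun x v => ?_
      have := LinearMap.congr_fun (cellRep_comm 𝕜 h σ g) x
      simp only [LinearMap.comp_apply] at this
      simp [this]⟩
  map_one' := by ext; simp
  map_mul' σ τ := by ext; simp

/-- The Kronecker coefficient `k_{lam, mu}^nu` for `IS_n`: the multiplicity of `N^nu` in
`N^lam ⊗ N^mu`, on which `IS_n` acts diagonally. -/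
def isKroneckerCoeff (𝕜 : Type*) [Field 𝕜] {n k l m : ℕ} (hk : k ≤ n) (hl : l ≤ n) (hm : m ≤ n)
    (lam : k.Partition) (mu : l.Partition) (nu : m.Partition) : ℕ :=
  multiplicity (N 𝕜 hm nu) ((N 𝕜 hk lam).tprod (N 𝕜 hl mu))

end ISKron

end

noncomputable section

namespace ISKron

section

/-! ### Traces and composition multiplicities -/

/-! The proof computes with characters. If an element `x` of the monoid algebra has trace one on a
simple module and trace zero on all other simple modules, then, the trace being additive along a
composition series, the trace of `x` on a finite-dimensional module is the multiplicity sought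
(`multiplicity_eq_trace`). Semisimplicity of the algebra of `IS n` is not needed.

For `ν ⊢ m` such an element is `x = (1/m!) ∑_g χ_ν(g) ∑_T (-1)^|T| e_T g`, where `g` runs over
`S_m`, `T` over the subsets of the first `m` points, and `e_T` is the idempotent on the complement
of `T` in these points (`cellTest`). The alternating sum strips off the part of `g` that factors
through smaller domains. A nonzero trace on an irreducible `τ` yields a nonzero map `N^ν → τ`, hence
an isomorphism (`trace_cellTest_eq_zero`); on `N^ν` itself the trace is `⟨χ_ν, χ_ν⟩ = 1`
(`trace_cellTest_N`).

The character of `N^λ` at `σ` is the average over `r ∈ S_k` of `χ_λ(r)` times the number of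
embeddings `p` with `σ p = p r` (`N_character`). For `N^λ ⊗ N^μ` one counts pairs of embeddings, and
the sum over `T` is an inclusion-exclusion that keeps the pairs whose images cover all `m` points.
Hence the coefficient is the average over `S_m × S_k × S_l` of `χ_ν χ_λ χ_μ` times the number of
fixed covering pairs (`isKroneckerCoeff_eq_avg`).

Covering pairs exist only for `max k l ≤ m ≤ k + l`, which gives (a). In that range the two images
overlap in exactly `b` points, so the action on covering pairs is transitive, with stabilizer `S_a ×
S_b × S_c` (`smul_standardPair_iff`). Averaging against a transitive permutation character is
averaging over a stabilizer (`avg_mul_card_fixedBy`), so the coefficient is the average of `χ_λ(u,v)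
χ_μ(w,v) χ_ν(u,v,w)`. The sum in (b) collapses to the same average (`sum_coeffs_eq_avg`), because
Specht characters form an orthonormal basis of the class functions. That is proved here by James's
argument with column antisymmetrizers and a count of conjugacy classes. -/

theorem trace_eq_add_of_exact {𝕜 U M Q : Type*} [Field 𝕜] [AddCommGroup U] [Module 𝕜 U]
    [AddCommGroup M] [Module 𝕜 M] [AddCommGroup Q] [Module 𝕜 Q] [FiniteDimensional 𝕜 M]
    {i : U →ₗ[𝕜] M} {p : M →ₗ[𝕜] Q} (hi : Function.Injective i) (hp : Function.Surjective p)
    (hip : LinearMap.range i = LinearMap.ker p) {f : Module.End 𝕜 M} {fU : Module.End 𝕜 U}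
    {fQ : Module.End 𝕜 Q} (hU : f ∘ₗ i = i ∘ₗ fU) (hQ : p ∘ₗ f = fQ ∘ₗ p) :
    LinearMap.trace 𝕜 M f = LinearMap.trace 𝕜 U fU + LinearMap.trace 𝕜 Q fQ := by
  have : FiniteDimensional 𝕜 U := FiniteDimensional.of_injective i hi
  have : FiniteDimensional 𝕜 Q := Module.Finite.of_surjective p hp
  obtain ⟨r, hr⟩ := i.exists_leftInverse_of_injective (LinearMap.ker_eq_bot.2 hi)
  obtain ⟨s, hs⟩ := p.exists_rightInverse_of_surjective (LinearMap.range_eq_top.2 hp)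
  have hpi : ∀ u, p (i u) = 0 := fun u => by
    have : i u ∈ LinearMap.ker p := hip ▸ ⟨u, rfl⟩
    exact this
  -- The linear splittings `r` and `s` need not commute with `f`. They only cut `f` into two
  -- products whose traces move, by cyclicity, to `U` and to `Q`.
  have h1 : f = (f ∘ₗ i) ∘ₗ (r ∘ₗ (LinearMap.id - s ∘ₗ p)) + f ∘ₗ (s ∘ₗ p) := by
    ext v
    obtain ⟨u, hu⟩ : v - s (p v) ∈ LinearMap.range i := by
      rw [hip, LinearMap.mem_ker, map_sub, sub_eq_zero]
      exact (LinearMap.congr_fun hs (p v)).symm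
    have : r (i u) = u := LinearMap.congr_fun hr u
    simp only [LinearMap.add_apply, LinearMap.comp_apply, LinearMap.sub_apply, LinearMap.id_apply,
      ← hu, this]
    rw [hu, map_sub]; simp
  have h2 : (r ∘ₗ (LinearMap.id - s ∘ₗ p)) ∘ₗ (f ∘ₗ i) = fU := by
    ext u
    have h3 : f (i u) = i (fU u) := LinearMap.congr_fun hU u
    simp only [LinearMap.comp_apply, LinearMap.sub_apply, LinearMap.id_apply, h3, hpi, map_zero,
      sub_zero]
    exact LinearMap.congr_fun hr _
  have h4 : p ∘ₗ (f ∘ₗ s) = fQ := by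
    rw [← LinearMap.comp_assoc, hQ, LinearMap.comp_assoc, hs, LinearMap.comp_id]
  rw [h1, map_add, LinearMap.trace_comp_comm', h2, ← LinearMap.comp_assoc,
    LinearMap.trace_comp_comm', h4]

section Algebra

variable {𝕜 A M : Type*} [Field 𝕜] [Ring A] [Algebra 𝕜 A] [AddCommGroup M] [Module 𝕜 M]
  [Module A M] [IsScalarTower 𝕜 A M]

/-- The trace of the action of an element of an algebra on a module. -/
def actTrace (𝕜 : Type*) {A : Type*} (M : Type*) [Field 𝕜] [Ring A] [Algebra 𝕜 A]
    [AddCommGroup M] [Module 𝕜 M] [Module A M] [IsScalarTower 𝕜 A M] (x : A) : 𝕜 :=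
  LinearMap.trace 𝕜 M (Algebra.lsmul 𝕜 𝕜 M x)

theorem actTrace_congr {N : Type*} [AddCommGroup N] [Module 𝕜 N] [Module A N]
    [IsScalarTower 𝕜 A N] (e : M ≃ₗ[A] N) (x : A) : actTrace 𝕜 M x = actTrace 𝕜 N x := by
  unfold actTrace
  rw [← LinearMap.trace_conj' _ (e.restrictScalars 𝕜)]
  congr 1
  ext v
  simp [LinearEquiv.conj_apply]

theorem actTrace_eq_add_of_exact {U Q : Type*} [FiniteDimensional 𝕜 M] [AddCommGroup U]
    [Module 𝕜 U] [Module A U] [IsScalarTower 𝕜 A U] [AddCommGroup Q] [Module 𝕜 Q] [Module A Q]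
    [IsScalarTower 𝕜 A Q] (i : U →ₗ[A] M) (p : M →ₗ[A] Q) (hi : Function.Injective i)
    (hp : Function.Surjective p) (hip : LinearMap.range i = LinearMap.ker p) (x : A) :
    actTrace 𝕜 M x = actTrace 𝕜 U x + actTrace 𝕜 Q x := by
  refine trace_eq_add_of_exact (i := i.restrictScalars 𝕜) (p := p.restrictScalars 𝕜) hi hp ?_ ?_ ?_
  · ext v
    exact SetLike.ext_iff.1 hip v
  · ext v
    exact (i.map_smul x v).symm
  · ext v
    exact p.map_smul x v

theorem finiteDimensional_submodule [FiniteDimensional 𝕜 M] (q : Submodule A M) :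
    FiniteDimensional 𝕜 q :=
  FiniteDimensional.of_injective (q.subtype.restrictScalars 𝕜) q.subtype_injective

theorem finiteDimensional_quotient [FiniteDimensional 𝕜 M] (q : Submodule A M) :
    FiniteDimensional 𝕜 (M ⧸ q) := by
  have h : Function.Surjective (q.mkQ.restrictScalars 𝕜) := Submodule.mkQ_surjective q
  exact Module.Finite.of_surjective _ h

theorem actTrace_submodule_eq_add [FiniteDimensional 𝕜 M] {p q : Submodule A M} (h : p ≤ q)
    (x : A) : actTrace 𝕜 q x = actTrace 𝕜 p x + actTrace 𝕜 (q ⧸ p.submoduleOf q) x := by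
  have := finiteDimensional_submodule (𝕜 := 𝕜) q
  refine actTrace_eq_add_of_exact (Submodule.inclusion h) (p.submoduleOf q).mkQ
    (Submodule.inclusion_injective h) (Submodule.mkQ_surjective _) ?_ x
  rw [Submodule.ker_mkQ, Submodule.range_inclusion, Submodule.submoduleOf]

theorem actTrace_compositionSeries [FiniteDimensional 𝕜 M]
    (s : CompositionSeries (Submodule A M)) (h0 : s.head = ⊥) (h1 : s.last = ⊤) (x : A) :
    actTrace 𝕜 M x =
      ∑ i : Fin s.length, actTrace 𝕜 (s i.succ ⧸ (s i.castSucc).submoduleOf (s i.succ)) x := by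
  have hstep : ∀ i : Fin s.length,
      actTrace 𝕜 (s i.succ ⧸ (s i.castSucc).submoduleOf (s i.succ)) x =
        actTrace 𝕜 (s i.succ) x - actTrace 𝕜 (s i.castSucc) x := fun i => by
    rw [actTrace_submodule_eq_add (𝕜 := 𝕜) (s.step i).le x, add_sub_cancel_left]
  have hM : actTrace 𝕜 M x = actTrace 𝕜 s.last x - actTrace 𝕜 s.head x := by
    have e1 : actTrace 𝕜 s.last x = actTrace 𝕜 M x := by
      rw [h1]; exact actTrace_congr Submodule.topEquiv x
    have e2 : actTrace 𝕜 s.head x = 0 := by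
      rw [h0]
      unfold actTrace
      rw [Subsingleton.elim (Algebra.lsmul 𝕜 𝕜 (⊥ : Submodule A M) x) 0, map_zero]
    rw [e1, e2, sub_zero]
  rw [hM, Finset.sum_congr rfl fun i _ => hstep i]
  have key : ∀ (n : ℕ) (T : Fin (n + 1) → 𝕜),
      T (Fin.last n) - T 0 = ∑ i : Fin n, (T i.succ - T i.castSucc) := by
    intro n T
    induction n with
    | zero => simp
    | succ n ih =>
      rw [Fin.sum_univ_castSucc]
      have := ih fun i => T i.castSucc
      simp only [Fin.succ_castSucc, Fin.succ_last, Fin.castSucc_zero] at this ⊢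
      rw [← this]
      ring
  exact key s.length fun i => actTrace 𝕜 (s i) x

/-- By additivity of the trace, each composition factor isomorphic to `N` contributes one and every
other factor contributes zero. -/
theorem compositionMultiplicity_eq_actTrace [FiniteDimensional 𝕜 M] {N : Type*} [AddCommGroup N]
    [Module 𝕜 N] [Module A N] [IsScalarTower 𝕜 A N] (x : A) (h1 : actTrace 𝕜 N x = 1)
    (h0 : ∀ p q : Submodule A M, IsSimpleModule A (q ⧸ p.submoduleOf q) →
      IsEmpty ((q ⧸ p.submoduleOf q) ≃ₗ[A] N) → actTrace 𝕜 (q ⧸ p.submoduleOf q) x = 0) :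
    (compositionMultiplicity A N M : 𝕜) = actTrace 𝕜 M x := by
  have : IsNoetherian A M := isNoetherian_of_tower 𝕜 inferInstance
  have : IsArtinian A M := isArtinian_of_tower 𝕜 inferInstance
  obtain ⟨s0, h00, h01⟩ := exists_compositionSeries_of_isNoetherian_isArtinian A M
  -- A series attaining the infimum is enough, so the uniqueness part of Jordan-Hölder is not used;
  -- `s0` only shows that the set is nonempty.
  obtain ⟨s, hs0, hs1, hc⟩ := Nat.sInf_mem (s := {c : ℕ | ∃ s : CompositionSeries (Submodule A M),
    s.head = ⊥ ∧ s.last = ⊤ ∧ c = Nat.card {i : Fin s.length //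
      Nonempty ((s i.succ ⧸ (s i.castSucc).submoduleOf (s i.succ)) ≃ₗ[A] N)}})
    ⟨_, s0, h00, h01, rfl⟩
  unfold compositionMultiplicity
  rw [hc, actTrace_compositionSeries s hs0 hs1 x]
  classical
  rw [Nat.card_eq_fintype_card, Fintype.card_subtype, Finset.card_eq_sum_ones, Finset.sum_filter,
    Nat.cast_sum]
  refine Finset.sum_congr rfl fun i _ => ?_
  split_ifs with h
  · obtain ⟨e⟩ := h
    rw [actTrace_congr e, h1, Nat.cast_one]
  · rw [Nat.cast_zero]
    exact (h0 _ _ ((covBy_iff_quot_is_simple (s.step i).le).1 (s.step i))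
      (not_nonempty_iff.1 h)).symm

end Algebra

/-- A module over a monoid algebra as a representation. -/
def repOfModule (𝕜 G M : Type*) [Field 𝕜] [Monoid G] [AddCommGroup M] [Module 𝕜 M]
    [Module (MonoidAlgebra 𝕜 G) M] [IsScalarTower 𝕜 (MonoidAlgebra 𝕜 G) M] :
    Representation 𝕜 G M :=
  (Algebra.lsmul 𝕜 𝕜 M : MonoidAlgebra 𝕜 G →ₐ[𝕜] Module.End 𝕜 M).toMonoidHom.comp
    (MonoidAlgebra.of 𝕜 G)

section RepOfModule

variable {𝕜 G M : Type*} [Field 𝕜] [Monoid G] [AddCommGroup M] [Module 𝕜 M]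
    [Module (MonoidAlgebra 𝕜 G) M] [IsScalarTower 𝕜 (MonoidAlgebra 𝕜 G) M]

theorem repOfModule_asAlgebraHom (x : MonoidAlgebra 𝕜 G) :
    (repOfModule 𝕜 G M).asAlgebraHom x = Algebra.lsmul 𝕜 𝕜 M x := by
  have : (repOfModule 𝕜 G M).asAlgebraHom = Algebra.lsmul 𝕜 𝕜 M := by
    apply MonoidAlgebra.algHom_ext
    · intro g
      rw [Representation.asAlgebraHom_single_one, repOfModule, MonoidHom.comp_apply,
        MonoidAlgebra.of_apply]
      rfl
    · exact Subsingleton.elim _ _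
  rw [this]

/-- The module of the representation attached to a module is the given module. -/
def repOfModuleEquiv : (repOfModule 𝕜 G M).asModule ≃ₗ[MonoidAlgebra 𝕜 G] M :=
  { (repOfModule 𝕜 G M).asModuleEquiv.toAddEquiv with
    map_smul' := fun x v => by
      change (repOfModule 𝕜 G M).asModuleEquiv (x • v) = _
      rw [Representation.asModuleEquiv_map_smul, repOfModule_asAlgebraHom]
      rfl }

end RepOfModule

theorem actTrace_asModule {𝕜 G V : Type*} [Field 𝕜] [Monoid G] [AddCommGroup V] [Module 𝕜 V]
    (ρ : Representation 𝕜 G V) (x : MonoidAlgebra 𝕜 G) :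
    actTrace 𝕜 ρ.asModule x = LinearMap.trace 𝕜 V (ρ.asAlgebraHom x) := by
  unfold actTrace
  rw [← LinearMap.trace_conj' _ ρ.asModuleEquiv]
  congr 1

theorem actTrace_eq_zero_of_simple {𝕜 G W Q : Type*} [Field 𝕜] [Monoid G]
    [AddCommGroup W] [Module 𝕜 W] [AddCommGroup Q] [Module 𝕜 Q] [Module (MonoidAlgebra 𝕜 G) Q]
    [IsScalarTower 𝕜 (MonoidAlgebra 𝕜 G) Q] (σ : Representation 𝕜 G W) (x : MonoidAlgebra 𝕜 G)
    (h0 : ∀ τ : Representation 𝕜 G Q, τ.IsIrreducible → IsEmpty (τ.Equiv σ) →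
      LinearMap.trace 𝕜 Q (τ.asAlgebraHom x) = 0)
    (hQ : IsSimpleModule (MonoidAlgebra 𝕜 G) Q)
    (hempty : IsEmpty (Q ≃ₗ[MonoidAlgebra 𝕜 G] σ.asModule)) : actTrace 𝕜 Q x = 0 := by
  rw [actTrace, ← repOfModule_asAlgebraHom]
  refine h0 _ ((Representation.irreducible_iff_isSimpleModule_asModule _).2
      (IsSimpleModule.congr repOfModuleEquiv)) ⟨fun e => hempty.false
        (repOfModuleEquiv.symm.trans (LinearEquiv.ofBijective
          (Representation.IntertwiningMap.equivLinearMapAsModule _ _ e.toIntertwiningMap)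
          e.toLinearEquiv.bijective))⟩

/-- A multiplicity is the trace of any element that has trace one on the given simple module and
trace zero on all other simple modules. -/
theorem multiplicity_eq_trace.{u} {𝕜 G W : Type*} {V : Type u} [Field 𝕜] [Monoid G]
    [AddCommGroup W] [Module 𝕜 W] [AddCommGroup V] [Module 𝕜 V] [FiniteDimensional 𝕜 V]
    (σ : Representation 𝕜 G W) (ρ : Representation 𝕜 G V) (x : MonoidAlgebra 𝕜 G)
    (h1 : LinearMap.trace 𝕜 W (σ.asAlgebraHom x) = 1)
    (h0 : ∀ (S : Type u) [AddCommGroup S] [Module 𝕜 S] [FiniteDimensional 𝕜 S]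
      (τ : Representation 𝕜 G S), τ.IsIrreducible → IsEmpty (τ.Equiv σ) →
      LinearMap.trace 𝕜 S (τ.asAlgebraHom x) = 0) :
    (multiplicity σ ρ : 𝕜) = LinearMap.trace 𝕜 V (ρ.asAlgebraHom x) := by
  unfold multiplicity
  rw [compositionMultiplicity_eq_actTrace (𝕜 := 𝕜) x ((actTrace_asModule σ x).trans h1),
    actTrace_asModule]
  -- The subquotients of `V` lie in the universe of `V`, so it suffices that `h0` quantifies over
  -- that universe.
  intro p q hsimple hempty
  have := finiteDimensional_submodule (𝕜 := 𝕜) q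
  have := finiteDimensional_quotient (𝕜 := 𝕜) (p.submoduleOf q)
  exact actTrace_eq_zero_of_simple σ x (fun τ => h0 _ τ) hsimple hempty

end

section

/-! ### Characters -/

theorem trace_sum_single {𝕜 G V ι : Type*} [Field 𝕜] [Monoid G] [AddCommGroup V] [Module 𝕜 V]
    (ρ : Representation 𝕜 G V) (s : Finset ι) (f : ι → G) (c : ι → 𝕜) :
    LinearMap.trace 𝕜 V (ρ.asAlgebraHom (∑ i ∈ s, MonoidAlgebra.single (f i) (c i))) =
      ∑ i ∈ s, c i * ρ.character (f i) := by
  rw [map_sum, map_sum]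
  refine Finset.sum_congr rfl fun i _ => ?_
  rw [Representation.asAlgebraHom_single, map_smul, smul_eq_mul, Representation.character]

section Group

variable {𝕜 G W : Type*} [Field 𝕜] [CharZero 𝕜] [Group G] [Fintype G] [AddCommGroup W] [Module 𝕜 W]

/-- The test element is the average of `σ.character g⁻¹ • g`; the two conditions on its traces are
the orthogonality relations for irreducible characters. -/
theorem multiplicity_eq_sum_character {V : Type*} [IsAlgClosed 𝕜] [FiniteDimensional 𝕜 W]
    [AddCommGroup V] [Module 𝕜 V] [FiniteDimensional 𝕜 V]
    (σ : Representation 𝕜 G W) [σ.IsIrreducible] (ρ : Representation 𝕜 G V) :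
    (multiplicity σ ρ : 𝕜) =
      (Nat.card G : 𝕜)⁻¹ * ∑ g : G, ρ.character g * σ.character g⁻¹ := by
  have hG : (Nat.card G : 𝕜) ≠ 0 := Nat.cast_ne_zero.2 Nat.card_pos.ne'
  let _ : Invertible (Nat.card G : 𝕜) := invertibleOfNonzero hG
  have key : ∀ χ : G → 𝕜, ∑ g : G, (Nat.card G : 𝕜)⁻¹ * σ.character g⁻¹ * χ g =
      (Nat.card G : 𝕜)⁻¹ * ∑ g : G, χ g * σ.character g⁻¹ := by
    intro χ
    rw [Finset.mul_sum]
    exact Finset.sum_congr rfl fun g _ => by ring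
  rw [← key, ← trace_sum_single]
  refine multiplicity_eq_trace σ ρ _ ?_ ?_
  · rw [trace_sum_single, key, Representation.char_orthonormal, if_pos ⟨.refl σ⟩]
  · intro S _ _ _ τ hτ hempty
    rw [trace_sum_single, key, Representation.char_orthonormal, if_neg]
    rintro ⟨e⟩
    exact hempty.false e.symm

/-- The trace of the endomorphism induced on the coinvariants by an equivariant one. -/
theorem trace_coinvariants_map [FiniteDimensional 𝕜 W] (ρ : Representation 𝕜 G W)
    (T : ρ.IntertwiningMap ρ) :
    LinearMap.trace 𝕜 _ (Representation.Coinvariants.map ρ ρ T) =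
      (Nat.card G : 𝕜)⁻¹ * ∑ g : G, LinearMap.trace 𝕜 W (T.toLinearMap ∘ₗ ρ g) := by
  have hG : (Nat.card G : 𝕜) ≠ 0 := Nat.cast_ne_zero.2 Nat.card_pos.ne'
  -- The averaging operator vanishes on the kernel of the projection to the coinvariants and is the
  -- identity modulo it. So `T ∘ P` has trace zero on the kernel and induces the wanted map on the
  -- quotient.
  let P : W →ₗ[𝕜] W := (Nat.card G : 𝕜)⁻¹ • ∑ g : G, ρ g
  have hP : ∀ v ∈ Representation.Coinvariants.ker ρ, P v = 0 := by
    intro v hv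
    induction hv using Submodule.span_induction with
    | mem x hx =>
      obtain ⟨⟨g, y⟩, rfl⟩ := hx
      have : ∑ h : G, ρ h (ρ g y) = ∑ h : G, ρ h y := by
        rw [← Equiv.sum_comp (Equiv.mulRight g) fun h => ρ h y]
        simp
      simp [P, LinearMap.sum_apply, this]
    | zero => simp
    | add x y _ _ hx hy => rw [map_add, hx, hy, add_zero]
    | smul a x _ hx => rw [map_smul, hx, smul_zero]
  have hmk : ∀ v, Representation.Coinvariants.mk ρ (P v) = Representation.Coinvariants.mk ρ v := by
    intro v
    simp only [P, LinearMap.smul_apply, LinearMap.sum_apply, map_smul, map_sum,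
      Representation.Coinvariants.mk_self_apply, Finset.sum_const, Finset.card_univ,
      ← Nat.card_eq_fintype_card]
    rw [← Nat.cast_smul_eq_nsmul 𝕜, smul_smul, inv_mul_cancel₀ hG, one_smul]
  have := trace_eq_add_of_exact (i := (Representation.Coinvariants.ker ρ).subtype)
    (p := Representation.Coinvariants.mk ρ) (f := T.toLinearMap ∘ₗ P) (fU := 0)
    (fQ := Representation.Coinvariants.map ρ ρ T) (Submodule.subtype_injective _)
    (Representation.Coinvariants.mk_surjective ρ)
    (by ext v; simp [Representation.Coinvariants.mk_eq_zero])
    (by ext v; simp [hP v v.2])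
    (by
      ext v
      change _ = Representation.Coinvariants.mk ρ (T v)
      have : T (P v) = P (T v) := by
        simp only [P, LinearMap.smul_apply, LinearMap.sum_apply, map_smul, map_sum,
          T.isIntertwining]
      change Representation.Coinvariants.mk ρ (T (P v)) = _
      rw [this, hmk])
  rw [map_zero, zero_add] at this
  rw [← this]
  simp only [P, LinearMap.comp_smul, map_smul, smul_eq_mul, Finset.mul_sum]
  rw [show T.toLinearMap ∘ₗ (∑ g : G, ρ g) = ∑ g : G, T.toLinearMap ∘ₗ ρ g by
    ext v; simp, map_sum, Finset.mul_sum]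

end Group

theorem trace_eq_sum_repr {𝕜 M ι : Type*} [Field 𝕜] [AddCommGroup M] [Module 𝕜 M] [Fintype ι]
    (b : Module.Basis ι 𝕜 M) (f : Module.End 𝕜 M) :
    LinearMap.trace 𝕜 M f = ∑ i, b.repr (f (b i)) i := by
  classical
  rw [LinearMap.trace_eq_matrix_trace 𝕜 b, Matrix.trace]
  simp [LinearMap.toMatrix_apply]

/-- The induced module is the coinvariants of `𝕜[H] ⊗ V` under `G`, with `x` acting on `𝕜[H]` by
right multiplication by `x⁻¹`. Composed with `φ g` this permutes the basis `H`, so its trace counts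
fixed points. -/
theorem ind_character {𝕜 G H V : Type*} [Field 𝕜] [CharZero 𝕜] [Group G] [Fintype G] [Group H]
    [Fintype H] [AddCommGroup V] [Module 𝕜 V] [FiniteDimensional 𝕜 V] (φ : G →* H)
    (ρ : Representation 𝕜 G V) (x : H) :
    (Representation.ind φ ρ).character x =
      (Nat.card G : 𝕜)⁻¹ * ∑ g : G, (Nat.card {y : H // φ g * y * x⁻¹ = y} : 𝕜) *
        ρ.character g := by
  let b : Module.Basis H 𝕜 (MonoidAlgebra 𝕜 H) :=
    Module.Basis.ofRepr (MonoidAlgebra.coeffLinearEquiv 𝕜)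
  have hb : ∀ y, b y = MonoidAlgebra.single y 1 := fun y => rfl
  have : FiniteDimensional 𝕜 (MonoidAlgebra 𝕜 H) := Module.Finite.of_basis b
  rw [Representation.character, Representation.ind_apply, trace_coinvariants_map]
  congr 1
  refine Finset.sum_congr rfl fun g _ => ?_
  have h1 : ((MonoidAlgebra.mapDomainLinearMap 𝕜 𝕜 fun y => y * x⁻¹).rTensor V) ∘ₗ
      (Representation.tprod ((Representation.leftRegular 𝕜 H).comp φ) ρ g) =
      TensorProduct.map ((MonoidAlgebra.mapDomainLinearMap 𝕜 𝕜 fun y => y * x⁻¹) ∘ₗ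
        (Representation.leftRegular 𝕜 H (φ g))) (ρ g) := by
    refine TensorProduct.ext' fun u v => ?_
    simp
  change LinearMap.trace 𝕜 _ (((MonoidAlgebra.mapDomainLinearMap 𝕜 𝕜 fun y => y * x⁻¹).rTensor V) ∘ₗ
      (Representation.tprod ((Representation.leftRegular 𝕜 H).comp φ) ρ g)) = _
  rw [h1, LinearMap.trace_tensorProduct', Representation.character]
  congr 1
  classical
  rw [trace_eq_sum_repr b, Nat.card_eq_fintype_card, Fintype.card_subtype,
    Finset.card_eq_sum_ones, Finset.sum_filter, Nat.cast_sum]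
  refine Finset.sum_congr rfl fun y _ => ?_
  rw [hb, LinearMap.comp_apply, Representation.ofMulAction_single,
    MonoidAlgebra.mapDomainLinearMap_single]
  change (MonoidAlgebra.single _ 1).coeff y = _
  rw [MonoidAlgebra.coeff_single, Finsupp.single_apply, smul_eq_mul]
  split_ifs <;> simp

end

section

/-! ### Combinatorics of tableaux -/

theorem card_cellsOfRowLens (w : List ℕ) : (YoungDiagram.cellsOfRowLens w).card = w.sum := by
  induction w with
  | nil => rfl
  | cons a w ih =>
    rw [YoungDiagram.cellsOfRowLens, Finset.card_union_of_disjoint, Finset.card_map, ih]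
    · simp
    · rw [Finset.disjoint_left]
      rintro ⟨i, j⟩ h1 h2
      simp only [Finset.mem_product, Finset.mem_singleton, Finset.mem_map] at h1 h2
      obtain ⟨c, _, hc⟩ := h2
      have := congrArg Prod.fst hc
      simp [h1.1] at this

theorem card_diagram {n : ℕ} (lam : n.Partition) : (diagram lam).cells.card = n := by
  have := card_cellsOfRowLens (lam.parts.sort (· ≥ ·))
  rw [← Multiset.sum_coe, Multiset.sort_eq, lam.parts_sum] at this
  exact this

instance {n : ℕ} (lam : n.Partition) : Fintype {c : ℕ × ℕ // c ∈ diagram lam} :=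
  Fintype.subtype (diagram lam).cells fun c => YoungDiagram.mem_cells c

theorem card_cells {n : ℕ} (lam : n.Partition) :
    Fintype.card {c : ℕ × ℕ // c ∈ diagram lam} = n :=
  (Fintype.card_of_subtype (diagram lam).cells fun c => YoungDiagram.mem_cells c).trans
    (card_diagram lam)

instance {n : ℕ} (lam : n.Partition) : Nonempty (Tableau lam) :=
  ⟨Fintype.equivOfCardEq ((card_cells lam).trans (Fintype.card_fin n).symm)⟩

theorem diagram_injective {n : ℕ} : Function.Injective (diagram (n := n)) := by
  intro lam mu h
  have key : ∀ lam : n.Partition, (diagram lam).rowLens = lam.parts.sort (· ≥ ·) := fun lam =>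
    YoungDiagram.rowLens_ofRowLens_eq_self fun x hx => lam.parts_pos ((Multiset.mem_sort _).1 hx)
  have h1 := key lam
  rw [h, key mu] at h1
  ext1
  rw [← Multiset.sort_eq lam.parts (· ≥ ·), ← h1, Multiset.sort_eq]

/-- The number of cells in the first `r` rows. -/
def rowCount {n : ℕ} (lam : n.Partition) (r : ℕ) : ℕ :=
  ((diagram lam).cells.filter fun c => c.1 < r).card

theorem rowCount_succ {n : ℕ} (lam : n.Partition) (r : ℕ) :
    rowCount lam (r + 1) = rowCount lam r + (diagram lam).rowLen r := by
  rw [YoungDiagram.rowLen_eq_card, rowCount, rowCount, YoungDiagram.row,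
    ← Finset.card_union_of_disjoint]
  · congr 1
    ext c
    simp only [Finset.mem_filter, Finset.mem_union, Nat.lt_succ_iff_lt_or_eq]
    tauto
  · rw [Finset.disjoint_left]
    intro c h1 h2
    simp only [Finset.mem_filter] at h1 h2
    omega

/-- `rowCount` gives the partial sums of the parts, so comparing it for all `r` is the dominance
order. This is the antisymmetry that separates Specht modules of different shapes. -/
theorem eq_of_rowCount_eq {n : ℕ} {lam mu : n.Partition}
    (h : ∀ r, rowCount lam r = rowCount mu r) : lam = mu := by
  refine diagram_injective (YoungDiagram.ext ?_)
  ext ⟨i, j⟩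
  have h1 := rowCount_succ lam i
  rw [h, h, rowCount_succ, add_right_inj] at h1
  rw [YoungDiagram.mem_cells, YoungDiagram.mem_cells, YoungDiagram.mem_iff_lt_rowLen,
    YoungDiagram.mem_iff_lt_rowLen, h1]

variable {n : ℕ} {lam mu : n.Partition}

theorem Tableau.card_row_lt (T : Tableau lam) (r : ℕ) :
    (Finset.univ.filter fun x => T.row x < r).card = rowCount lam r := by
  refine Finset.card_bij (fun x _ => (T.symm x).1) ?_ ?_ ?_
  · intro x hx
    simp only [Finset.mem_filter, Finset.mem_univ, true_and, YoungDiagram.mem_cells] at hx ⊢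
    exact ⟨(T.symm x).2, hx⟩
  · intro x _ y _ h
    exact T.symm.injective (Subtype.ext h)
  · intro c hc
    simp only [Finset.mem_filter, YoungDiagram.mem_cells] at hc
    exact ⟨T ⟨c, hc.1⟩, Finset.mem_filter.2 ⟨Finset.mem_univ _, by simpa [Tableau.row] using hc.2⟩,
      by simp⟩

theorem Tableau.ext_of_row_col (T : Tableau lam) {x y : Fin n} (h1 : T.row x = T.row y)
    (h2 : T.col x = T.col y) : x = y :=
  T.symm.injective (Subtype.ext (Prod.ext h1 h2))

theorem Tableau.row_lt_colLen (T : Tableau lam) (x : Fin n) :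
    T.row x < (diagram lam).colLen (T.col x) :=
  YoungDiagram.mem_iff_lt_colLen.1 (T.symm x).2

/-- An injective function on a column takes values below `r` at most `r` times, whereas the rows of
`T` fill the column from the top without gaps. -/
theorem Tableau.card_col_le (T : Tableau lam) {t : Fin n → ℕ}
    (ht : ∀ x y, T.col x = T.col y → t x = t y → x = y) (j r : ℕ) :
    (Finset.univ.filter fun x => T.col x = j ∧ t x < r).card ≤
      (Finset.univ.filter fun x => T.col x = j ∧ T.row x < r).card := by
  by_cases hr : r ≤ (diagram lam).colLen j
  · calc _ ≤ (Finset.range r).card := by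
          refine Finset.card_le_card_of_injOn t ?_ ?_
          · intro x hx
            simpa using (Finset.mem_filter.1 hx).2.2
          · intro x hx y hy h
            exact ht x y ((Finset.mem_filter.1 hx).2.1.trans (Finset.mem_filter.1 hy).2.1.symm) h
      _ ≤ _ := by
          refine Finset.card_le_card_of_surjOn T.row ?_
          intro i hi
          have hi' : i < r := by simpa using hi
          have hc : (i, j) ∈ diagram lam := YoungDiagram.mem_iff_lt_colLen.2 (hi'.trans_le hr)
          refine ⟨T ⟨(i, j), hc⟩, Finset.mem_coe.2 (Finset.mem_filter.2 ⟨Finset.mem_univ _, ?_⟩),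
            by simp [Tableau.row]⟩
          simpa [Tableau.row, Tableau.col] using hi'
  · refine Finset.card_le_card fun x hx => ?_
    simp only [Finset.mem_filter, Finset.mem_univ, true_and] at hx ⊢
    refine ⟨hx.1, ?_⟩
    have := T.row_lt_colLen x
    rw [hx.1] at this
    omega

theorem Tableau.card_lt_eq_sum (T : Tableau lam) (t : Fin n → ℕ) (r : ℕ) :
    (Finset.univ.filter fun x => t x < r).card =
      ∑ j ∈ Finset.univ.image T.col,
        (Finset.univ.filter fun x => T.col x = j ∧ t x < r).card := by
  rw [Finset.card_eq_sum_card_fiberwise (f := T.col) (t := Finset.univ.image T.col)]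
  · refine Finset.sum_congr rfl fun j _ => ?_
    rw [Finset.filter_filter]
    congr 1
    ext x
    simp [and_comm]
  · intro x _
    simp

/-- The dominance lemma, obtained by adding the bounds of `card_col_le` over all columns. -/
theorem Tableau.rowCount_le (T : Tableau lam) (t : Tabloid mu)
    (ht : ∀ x y, T.col x = T.col y → t.1 x = t.1 y → x = y) (r : ℕ) :
    rowCount mu r ≤ rowCount lam r := by
  obtain ⟨t, T', rfl⟩ := t
  rw [← T'.card_row_lt, ← T.card_row_lt, T.card_lt_eq_sum, T.card_lt_eq_sum T.row]
  exact Finset.sum_le_sum fun j _ => T.card_col_le ht j r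

/-- A tabloid meeting each column of `T` of the same shape in distinct rows is obtained from `T` by
a column permutation. -/
theorem Tableau.exists_column_perm (T : Tableau lam) (t : Tabloid lam)
    (ht : ∀ x y, T.col x = T.col y → t.1 x = t.1 y → x = y) :
    ∃ π : Equiv.Perm (Fin n), (∀ x, T.col (π x) = T.col x) ∧ t = (T.act π).tabloid := by
  -- For equal shapes the columnwise inequalities have equal sums, so each of them is an equality.
  have hcard : ∀ j r, (Finset.univ.filter fun x => T.col x = j ∧ t.1 x < r).card =
      (Finset.univ.filter fun x => T.col x = j ∧ T.row x < r).card := by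
    intro j r
    by_cases hj : j ∈ Finset.univ.image T.col
    · have hsum : ∑ j ∈ Finset.univ.image T.col,
          (Finset.univ.filter fun x => T.col x = j ∧ t.1 x < r).card =
        ∑ j ∈ Finset.univ.image T.col,
          (Finset.univ.filter fun x => T.col x = j ∧ T.row x < r).card := by
        rw [← T.card_lt_eq_sum, ← T.card_lt_eq_sum, T.card_row_lt]
        obtain ⟨t, T', rfl⟩ := t
        exact T'.card_row_lt r
      exact (Finset.sum_eq_sum_iff_of_le fun j _ => T.card_col_le ht j r).1 hsum j hj
    · have : ∀ x, T.col x ≠ j := fun x hx => hj (hx ▸ by simp)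
      simp [this]
  have hlt : ∀ x, t.1 x < (diagram lam).colLen (T.col x) := by
    intro x
    have h1 := hcard (T.col x) ((diagram lam).colLen (T.col x))
    have h2 : (Finset.univ.filter fun y => T.col y = T.col x ∧
        T.row y < (diagram lam).colLen (T.col x)) =
        Finset.univ.filter fun y => T.col y = T.col x := by
      ext y
      simp only [Finset.mem_filter, Finset.mem_univ, true_and, and_iff_left_iff_imp]
      intro hy
      rw [← hy]
      exact T.row_lt_colLen y
    rw [h2] at h1
    have h3 := Finset.eq_of_subset_of_card_le (fun y hy => by
      simp only [Finset.mem_filter, Finset.mem_univ, true_and] at hy ⊢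
      exact hy.1) h1.ge
    have h4 : x ∈ Finset.univ.filter fun y => T.col y = T.col x := by simp
    rw [← h3] at h4
    exact (Finset.mem_filter.1 h4).2.2
  -- Each entry keeps its column and moves to the row prescribed by `t`. By `hlt` this is a cell of
  -- the diagram, and the tableau `S` obtained in this way has tabloid `t` and differs from `T` by a
  -- column permutation.
  let f : Fin n → {c : ℕ × ℕ // c ∈ diagram lam} := fun x =>
    ⟨(t.1 x, T.col x), YoungDiagram.mem_iff_lt_colLen.2 (hlt x)⟩
  have hf : Function.Injective f := by
    intro x y h
    have h' : (t.1 x, T.col x) = (t.1 y, T.col y) := congrArg Subtype.val h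
    exact ht x y (Prod.ext_iff.1 h').2 (Prod.ext_iff.1 h').1
  have hfb : Function.Bijective f :=
    (Fintype.bijective_iff_injective_and_card f).2 ⟨hf, by rw [card_cells, Fintype.card_fin]⟩
  let S : Tableau lam := (Equiv.ofBijective f hfb).symm
  have hS : ∀ x, S.symm x = f x := fun x => rfl
  refine ⟨T.symm.trans S, fun x => ?_, ?_⟩
  · have h1 : S.symm (S (T.symm x)) = T.symm x := S.symm_apply_apply _
    rw [hS] at h1
    exact congrArg (fun c => c.1.2) h1
  · have : T.act (T.symm.trans S) = S := by
      ext c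
      simp [Tableau.act]
    rw [this]
    rfl

end

section

/-! ### Irreducibility and completeness of the Specht modules -/

variable {𝕜 : Type*} [Field 𝕜] {n : ℕ} {lam mu : n.Partition}

/-- The column stabilizer of a tableau. -/
def Tableau.colStab (T : Tableau lam) : Finset (Equiv.Perm (Fin n)) :=
  Finset.univ.filter fun π => ∀ x, T.col (π x) = T.col x

theorem Tableau.mem_colStab {T : Tableau lam} {π : Equiv.Perm (Fin n)} :
    π ∈ T.colStab ↔ ∀ x, T.col (π x) = T.col x := by
  simp [Tableau.colStab]

theorem Tableau.mul_mem_colStab {T : Tableau lam} {π ρ : Equiv.Perm (Fin n)}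
    (hρ : ρ ∈ T.colStab) : π * ρ ∈ T.colStab ↔ π ∈ T.colStab := by
  rw [mem_colStab] at *
  rw [mem_colStab]
  constructor
  · intro h x
    have h1 := h (ρ⁻¹ x)
    have h2 := hρ (ρ⁻¹ x)
    rw [Equiv.Perm.mul_apply] at h1
    have h3 : ρ (ρ⁻¹ x) = x := Equiv.apply_symm_apply ρ x
    rw [h3] at h1 h2
    rw [h1, h2]
  · intro h x
    rw [Equiv.Perm.mul_apply, h, hρ]

/-- The sign of a permutation in a field. -/
def signIn (𝕜 : Type*) [Field 𝕜] (π : Equiv.Perm (Fin n)) : 𝕜 := ((Equiv.Perm.sign π : ℤ) : 𝕜)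

theorem signIn_mul (π ρ : Equiv.Perm (Fin n)) : signIn 𝕜 (π * ρ) = signIn 𝕜 π * signIn 𝕜 ρ := by
  simp [signIn]

theorem signIn_mul_self (π : Equiv.Perm (Fin n)) : signIn 𝕜 π * signIn 𝕜 π = 1 := by
  rw [signIn, ← Int.cast_mul, Int.units_coe_mul_self, Int.cast_one]

section Antisym

variable {V W : Type*} [AddCommGroup V] [Module 𝕜 V] [AddCommGroup W] [Module 𝕜 W]

/-- The signed sum over the column stabilizer of `T`, acting on a representation. -/
def colAntisym (T : Tableau lam) (ρ : Representation 𝕜 (Equiv.Perm (Fin n)) V) : Module.End 𝕜 V :=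
  ∑ π ∈ T.colStab, signIn 𝕜 π • ρ π

theorem colAntisym_apply (T : Tableau lam) (ρ : Representation 𝕜 (Equiv.Perm (Fin n)) V) (v : V) :
    colAntisym T ρ v = ∑ π ∈ T.colStab, signIn 𝕜 π • ρ π v := by
  simp [colAntisym]

theorem colAntisym_act {T : Tableau lam} (ρ : Representation 𝕜 (Equiv.Perm (Fin n)) V)
    {π : Equiv.Perm (Fin n)} (hπ : π ∈ T.colStab) (v : V) :
    colAntisym T ρ (ρ π v) = signIn 𝕜 π • colAntisym T ρ v := by
  rw [colAntisym_apply, colAntisym_apply, Finset.smul_sum]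
  refine Finset.sum_equiv (Equiv.mulRight π) (fun τ => ?_) fun τ _ => ?_
  · exact (Tableau.mul_mem_colStab hπ).symm
  · rw [Equiv.coe_mulRight, signIn_mul, map_mul, smul_smul, mul_left_comm, signIn_mul_self,
      mul_one, Module.End.mul_apply]

theorem colAntisym_colAntisym (T : Tableau lam) (ρ : Representation 𝕜 (Equiv.Perm (Fin n)) V)
    (v : V) : colAntisym T ρ (colAntisym T ρ v) = (T.colStab.card : 𝕜) • colAntisym T ρ v := by
  conv_lhs => rw [colAntisym_apply T ρ v, map_sum]
  rw [Finset.sum_congr rfl fun π hπ => by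
    rw [map_smul, colAntisym_act ρ hπ, smul_smul, signIn_mul_self, one_smul]]
  rw [Finset.sum_const, Nat.cast_smul_eq_nsmul]

theorem map_colAntisym (T : Tableau lam) {ρ : Representation 𝕜 (Equiv.Perm (Fin n)) V}
    {σ : Representation 𝕜 (Equiv.Perm (Fin n)) W} (f : ρ.IntertwiningMap σ) (v : V) :
    f (colAntisym T ρ v) = colAntisym T σ (f v) := by
  rw [colAntisym_apply, colAntisym_apply, map_sum]
  exact Finset.sum_congr rfl fun π _ => by rw [map_smul, f.isIntertwining]

theorem colAntisym_mem {ρ : Representation 𝕜 (Equiv.Perm (Fin n)) V} (U : Subrepresentation ρ)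
    (T : Tableau lam) {v : V} (hv : v ∈ U.toSubmodule) : colAntisym T ρ v ∈ U.toSubmodule := by
  rw [colAntisym_apply]
  exact Submodule.sum_mem _ fun π _ => Submodule.smul_mem _ _ (U.apply_mem_toSubmodule π hv)

end Antisym

theorem tabloidRep_single (g : Equiv.Perm (Fin n)) (t : Tabloid lam) (a : 𝕜) :
    tabloidRep 𝕜 lam g (Finsupp.single t a) = Finsupp.single (Tabloid.act g t) a :=
  Finsupp.mapDomain_single

theorem polytabloid_eq_colAntisym (T : Tableau lam) :
    polytabloid 𝕜 T = colAntisym T (tabloidRep 𝕜 lam) (Finsupp.single T.tabloid 1) := by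
  rw [colAntisym_apply, polytabloid]
  refine Finset.sum_congr rfl fun π _ => ?_
  rw [tabloidRep_single, Finsupp.smul_single, smul_eq_mul, mul_one, Tableau.tabloid_act, signIn]

theorem one_mem_colStab (T : Tableau lam) : 1 ∈ T.colStab := by
  simp [Tableau.mem_colStab]

/-- The coefficient at `T.tabloid` is one, since a permutation that preserves both the rows and the
columns of `T` is trivial. -/
theorem polytabloid_ne_zero (T : Tableau lam) : polytabloid 𝕜 T ≠ 0 := by
  intro h
  have h1 := DFunLike.congr_fun h T.tabloid
  rw [polytabloid, Finsupp.finsetSum_apply, Finset.sum_eq_single 1] at h1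
  · rw [show T.act 1 = T from rfl] at h1
    simp at h1
  · intro π hπ hne
    rw [Finsupp.single_apply, if_neg]
    intro h2
    apply hne
    have h3 : ∀ x, T.row (π⁻¹ x) = T.row x := fun x =>
      congrFun (congrArg Subtype.val h2) x
    ext x
    have h4 := h3 (π x)
    have h5 : π⁻¹ (π x) = x := Equiv.symm_apply_apply π x
    rw [h5] at h4
    exact congrArg Fin.val (T.ext_of_row_col h4.symm ((Finset.mem_filter.1 hπ).2 x))
  · intro h1
    simp at h1

theorem colAntisym_polytabloid (T : Tableau lam) :
    colAntisym T (tabloidRep 𝕜 lam) (polytabloid 𝕜 T) =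
      (T.colStab.card : 𝕜) • polytabloid 𝕜 T := by
  rw [polytabloid_eq_colAntisym, colAntisym_colAntisym]

/-- The inclusion of the Specht module into the permutation module on tabloids. -/
def spechtIncl (𝕜 : Type*) [Field 𝕜] (lam : n.Partition) :
    (specht 𝕜 lam).IntertwiningMap (tabloidRep 𝕜 lam) :=
  ⟨(spechtSub 𝕜 lam).toSubmodule.subtype, fun _ => rfl⟩

theorem spechtIncl_injective : Function.Injective (spechtIncl 𝕜 lam) := Subtype.val_injective

/-- The polytabloid of a tableau as an element of the Specht module. -/
def spechtVec (𝕜 : Type*) [Field 𝕜] (T : Tableau lam) : SpechtV 𝕜 lam :=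
  ⟨polytabloid 𝕜 T, Submodule.subset_span ⟨T, rfl⟩⟩

theorem specht_spechtVec (g : Equiv.Perm (Fin n)) (T : Tableau lam) :
    specht 𝕜 lam g (spechtVec 𝕜 T) = spechtVec 𝕜 (T.act g) :=
  Subtype.ext (tabloidRep_polytabloid 𝕜 g T)

theorem specht_subrep_eq_top {U : Subrepresentation (specht 𝕜 lam)} {T : Tableau lam}
    (h : spechtVec 𝕜 T ∈ U.toSubmodule) : U = ⊤ := by
  have h1 : ∀ T' : Tableau lam, spechtVec 𝕜 T' ∈ U.toSubmodule := by
    intro T'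
    have : T' = T.act (T.symm.trans T') := by
      ext c
      simp [Tableau.act]
    rw [this, ← specht_spechtVec]
    exact U.apply_mem_toSubmodule _ h
  have h2 : (spechtSub 𝕜 lam).toSubmodule ≤
      U.toSubmodule.map (spechtSub 𝕜 lam).toSubmodule.subtype := by
    refine Submodule.span_le.2 ?_
    rintro _ ⟨T', rfl⟩
    exact ⟨spechtVec 𝕜 T', h1 T', rfl⟩
  refine Subrepresentation.ext (eq_top_iff.2 fun v _ => ?_)
  obtain ⟨w, hw, hwv⟩ := h2 v.2
  rwa [← Subtype.ext hwv]

variable [CharZero 𝕜]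

theorem card_colStab_ne_zero (T : Tableau lam) : (T.colStab.card : 𝕜) ≠ 0 :=
  Nat.cast_ne_zero.2 (Finset.card_ne_zero_of_mem (one_mem_colStab T))

/-- Two distinct entries in one column of `T` and one row of `t` give a transposition that fixes `t`
and changes the sign of the antisymmetrized vector, which therefore vanishes in characteristic zero.
-/
theorem injOn_columns_of_colAntisym_ne_zero (T : Tableau lam) (t : Tabloid mu)
    (h : colAntisym T (tabloidRep 𝕜 mu) (Finsupp.single t 1) ≠ 0) (x y : Fin n)
    (hc : T.col x = T.col y) (hr : t.1 x = t.1 y) : x = y := by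
  by_contra hne
  apply h
  have hmem : Equiv.swap x y ∈ T.colStab := by
    rw [Tableau.mem_colStab]
    intro z
    by_cases hx : z = x
    · rw [hx, Equiv.swap_apply_left, hc]
    · by_cases hy : z = y
      · rw [hy, Equiv.swap_apply_right, hc]
      · rw [Equiv.swap_apply_of_ne_of_ne hx hy]
  have hfix : Tabloid.act (Equiv.swap x y) t = t := by
    refine Subtype.ext (funext fun z => ?_)
    change t.1 ((Equiv.swap x y)⁻¹ z) = t.1 z
    rw [Equiv.swap_inv]
    by_cases hx : z = x
    · rw [hx, Equiv.swap_apply_left, hr]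
    · by_cases hy : z = y
      · rw [hy, Equiv.swap_apply_right, hr]
      · rw [Equiv.swap_apply_of_ne_of_ne hx hy]
  have h1 := colAntisym_act (tabloidRep 𝕜 mu) hmem (Finsupp.single t 1)
  rw [tabloidRep_single, hfix, signIn, Equiv.Perm.sign_swap hne] at h1
  simp only [Units.val_neg, Units.val_one, Int.cast_neg, Int.cast_one, neg_smul, one_smul] at h1
  exact self_eq_neg.1 h1

theorem rowCount_le_of_colAntisym_ne_zero (T : Tableau lam)
    (h : colAntisym T (tabloidRep 𝕜 mu) ≠ 0) (r : ℕ) : rowCount mu r ≤ rowCount lam r := by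
  by_contra hr
  apply h
  ext t : 2
  by_contra ht
  exact hr (T.rowCount_le t
    (injOn_columns_of_colAntisym_ne_zero (𝕜 := 𝕜) T t (by simpa using ht)) r)

/-- A tabloid not killed by the antisymmetrizer is a column permutation of `T`, by
`exists_column_perm`, and is thus sent to the polytabloid up to sign. -/
theorem colAntisym_mem_span (T : Tableau lam) (v : Tabloid lam →₀ 𝕜) :
    ∃ c : 𝕜, colAntisym T (tabloidRep 𝕜 lam) v = c • polytabloid 𝕜 T := by
  induction v using Finsupp.induction_linear with
  | zero => exact ⟨0, by simp⟩
  | add v w hv hw =>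
    obtain ⟨c, hc⟩ := hv
    obtain ⟨d, hd⟩ := hw
    exact ⟨c + d, by rw [map_add, hc, hd, add_smul]⟩
  | single t a =>
    by_cases h : colAntisym T (tabloidRep 𝕜 lam) (Finsupp.single t 1) = 0
    · refine ⟨0, ?_⟩
      rw [← mul_one a, ← smul_eq_mul, ← Finsupp.smul_single, map_smul, h, smul_zero, zero_smul]
    · obtain ⟨π, hπ, rfl⟩ :=
        T.exists_column_perm t (injOn_columns_of_colAntisym_ne_zero T t h)
      refine ⟨a * signIn 𝕜 π, ?_⟩
      rw [← mul_one a, ← smul_eq_mul, ← Finsupp.smul_single, map_smul, Tableau.tabloid_act,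
        ← tabloidRep_single, colAntisym_act _ (Tableau.mem_colStab.2 hπ),
        polytabloid_eq_colAntisym, smul_smul, smul_eq_mul, mul_one]

/-- The antisymmetrizer of `T` maps the Specht module into the line of the polytabloid and
multiplies the polytabloid by a nonzero scalar. Given a subrepresentation and a Maschke complement,
it cannot kill both components of the polytabloid. So one of the two contains the polytabloid, which
generates everything. -/
instance : (specht 𝕜 lam).IsIrreducible := by
  obtain ⟨T⟩ := (inferInstance : Nonempty (Tableau lam))
  have hne : spechtVec 𝕜 T ≠ 0 := fun h => polytabloid_ne_zero T (congrArg Subtype.val h)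
  refine { exists_pair_ne := ⟨⊥, ⊤, fun h => hne ?_⟩, eq_bot_or_eq_top := fun U => ?_ }
  · have : spechtVec 𝕜 T ∈ (⊤ : Subrepresentation (specht 𝕜 lam)).toSubmodule := trivial
    rw [← h] at this
    exact this
  · have : NeZero (Nat.card (Equiv.Perm (Fin n)) : 𝕜) := ⟨Nat.cast_ne_zero.2 Nat.card_pos.ne'⟩
    obtain ⟨U', hU'⟩ := exists_isCompl U
    have hscal : ∀ v, ∃ c : 𝕜, colAntisym T (specht 𝕜 lam) v = c • spechtVec 𝕜 T := by
      intro v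
      obtain ⟨c, hc⟩ := colAntisym_mem_span (𝕜 := 𝕜) T (spechtIncl 𝕜 lam v)
      refine ⟨c, spechtIncl_injective ?_⟩
      rw [map_colAntisym, hc, map_smul]
      rfl
    have hsum : spechtVec 𝕜 T ∈ U.toSubmodule ⊔ U'.toSubmodule := by
      rw [← Subrepresentation.toSubmodule_sup, hU'.sup_eq_top]
      trivial
    obtain ⟨u, hu, u', hu', huu⟩ := Submodule.mem_sup.1 hsum
    have hT : colAntisym T (specht 𝕜 lam) (spechtVec 𝕜 T) =
        (T.colStab.card : 𝕜) • spechtVec 𝕜 T := by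
      apply spechtIncl_injective
      rw [map_colAntisym, map_smul]
      exact colAntisym_polytabloid T
    obtain ⟨c, hc⟩ := hscal u
    obtain ⟨c', hc'⟩ := hscal u'
    have key : ∀ (X : Subrepresentation (specht 𝕜 lam)) (d : 𝕜) (w), w ∈ X.toSubmodule → d ≠ 0 →
        colAntisym T (specht 𝕜 lam) w = d • spechtVec 𝕜 T → X = ⊤ := by
      intro X d w hw hd hwd
      refine specht_subrep_eq_top (T := T) ?_
      have := X.toSubmodule.smul_mem d⁻¹ (colAntisym_mem X T hw)
      rwa [hwd, smul_smul, inv_mul_cancel₀ hd, one_smul] at this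
    by_cases h0 : c = 0
    · left
      have : U' = ⊤ := by
        refine key U' c' u' hu' ?_ hc'
        rintro rfl
        rw [← huu, map_add, hc, hc', h0, huu, zero_smul, zero_add] at hT
        exact smul_ne_zero (card_colStab_ne_zero T) hne hT.symm
      have h2 := hU'.inf_eq_bot
      rwa [this, inf_top_eq] at h2
    · exact Or.inr (key U c u hu h0 hc)

/-- The antisymmetrizer of a `lam`-tableau is nonzero on `S^lam`, hence on the isomorphic copy
inside the tabloids of shape `mu`, and the dominance lemma applies. -/
theorem rowCount_le_of_equiv (e : (specht 𝕜 lam).Equiv (specht 𝕜 mu)) (r : ℕ) :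
    rowCount mu r ≤ rowCount lam r := by
  obtain ⟨T⟩ := (inferInstance : Nonempty (Tableau lam))
  refine rowCount_le_of_colAntisym_ne_zero (𝕜 := 𝕜) T (fun h => ?_) r
  have h1 : colAntisym T (specht 𝕜 lam) (spechtVec 𝕜 T) =
      (T.colStab.card : 𝕜) • spechtVec 𝕜 T := by
    apply spechtIncl_injective
    rw [map_colAntisym, map_smul]
    exact colAntisym_polytabloid T
  have h2 := congrArg (fun v => spechtIncl 𝕜 mu (e.toIntertwiningMap v)) h1
  simp only [map_colAntisym, h, LinearMap.zero_apply, map_smul] at h2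
  have h3 := (smul_eq_zero.1 h2.symm).resolve_left (card_colStab_ne_zero T)
  rw [← map_zero (spechtIncl 𝕜 mu)] at h3
  have h4 := spechtIncl_injective h3
  have h5 : spechtVec 𝕜 T = 0 :=
    e.toLinearEquiv.injective (h4.trans (map_zero e.toLinearEquiv).symm)
  exact polytabloid_ne_zero (𝕜 := 𝕜) T (congrArg Subtype.val h5)

theorem eq_of_specht_equiv (e : (specht 𝕜 lam).Equiv (specht 𝕜 mu)) : lam = mu :=
  eq_of_rowCount_eq fun r => (rowCount_le_of_equiv e.symm r).antisymm (rowCount_le_of_equiv e r)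

end

section

/-! ### Averages over finite groups -/

section Average

variable {𝕜 G H : Type*} [Field 𝕜] [Fintype G] [Fintype H]

/-- The average of a function on a finite type. -/
def avg (f : G → 𝕜) : 𝕜 := (Nat.card G : 𝕜)⁻¹ * ∑ g, f g

theorem mul_avg (c : 𝕜) (f : G → 𝕜) : c * avg f = avg fun g => c * f g := by
  simp only [avg, Finset.mul_sum]
  exact Finset.sum_congr rfl fun g _ => by ring

theorem avg_mul (c : 𝕜) (f : G → 𝕜) : avg f * c = avg fun g => f g * c := by
  rw [mul_comm, mul_avg]
  simp only [mul_comm]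

theorem sum_avg {ι : Type*} (s : Finset ι) (f : ι → G → 𝕜) :
    ∑ i ∈ s, avg (f i) = avg fun g => ∑ i ∈ s, f i g := by
  simp only [avg]
  rw [← Finset.mul_sum, Finset.sum_comm]

theorem avg_comm (f : G → H → 𝕜) :
    (avg fun g => avg fun h => f g h) = avg fun h => avg fun g => f g h := by
  simp only [avg, Finset.mul_sum]
  rw [Finset.sum_comm]
  exact Finset.sum_congr rfl fun h _ => Finset.sum_congr rfl fun g _ => by ring

theorem avg_prod (f : G × H → 𝕜) : avg f = avg fun g => avg fun h => f (g, h) := by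
  simp only [avg, Finset.mul_sum, Fintype.sum_prod_type, Nat.card_prod, Nat.cast_mul, mul_inv]
  exact Finset.sum_congr rfl fun g _ => Finset.sum_congr rfl fun h _ => by ring

theorem avg_const [CharZero 𝕜] [Nonempty G] (c : 𝕜) : (avg fun _ : G => c) = c := by
  rw [avg, Finset.sum_const, Finset.card_univ, ← Nat.card_eq_fintype_card, nsmul_eq_mul,
    inv_mul_cancel_left₀ (Nat.cast_ne_zero.2 Nat.card_pos.ne')]

end Average

/-- Class functions on a group. -/
def IsClassFun {𝕜 G : Type*} [Group G] (f : G → 𝕜) : Prop := ∀ g h : G, f (h * g * h⁻¹) = f g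

theorem IsClassFun.comp {𝕜 G H : Type*} [Group G] [Group H] {f : H → 𝕜} (hf : IsClassFun f)
    (φ : G →* H) : IsClassFun (f ∘ φ) := fun g h => by
  simp only [Function.comp_apply, map_mul, map_inv]
  exact hf _ _

/-- Frobenius reciprocity for characters. -/
theorem avg_ind_character_mul {𝕜 G H V : Type*} [Field 𝕜] [CharZero 𝕜] [Group G] [Fintype G]
    [Group H] [Fintype H] [AddCommGroup V] [Module 𝕜 V] [FiniteDimensional 𝕜 V] (φ : G →* H)
    (ρ : Representation 𝕜 G V) {f : H → 𝕜} (hf : IsClassFun f) :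
    (avg fun x => (Representation.ind φ ρ).character x * f x) =
      avg fun g => ρ.character g * f (φ g) := by
  classical
  have h1 : ∀ x, (Representation.ind φ ρ).character x * f x =
      avg fun g => (Nat.card {y : H // φ g * y * x⁻¹ = y} : 𝕜) * ρ.character g * f x := fun x => by
    rw [ind_character, ← avg, avg_mul]
  simp only [h1]
  rw [avg_comm]
  congr 1
  funext g
  have h2 : ∀ x, (Nat.card {y : H // φ g * y * x⁻¹ = y} : 𝕜) * ρ.character g * f x =
      ρ.character g * ∑ y : H, if y⁻¹ * φ g * y = x then f x else 0 := by
    intro x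
    rw [Nat.card_eq_fintype_card, Fintype.card_subtype, Finset.card_eq_sum_ones,
      Finset.sum_filter, Nat.cast_sum, mul_comm (Finset.sum _ _), mul_assoc, Finset.sum_mul]
    congr 1
    refine Finset.sum_congr rfl fun y _ => ?_
    have : φ g * y * x⁻¹ = y ↔ y⁻¹ * φ g * y = x := by
      rw [mul_inv_eq_iff_eq_mul, mul_assoc, inv_mul_eq_iff_eq_mul]
    simp only [this]
    split_ifs <;> simp
  simp only [h2]
  rw [← mul_avg, avg, Finset.sum_comm]
  congr 1
  have h3 : ∀ y : H, ∑ x, (if y⁻¹ * φ g * y = x then f x else 0) = f (φ g) := fun y => by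
    rw [Finset.sum_ite_eq, if_pos (Finset.mem_univ _)]
    have := hf (φ g) y⁻¹
    rwa [inv_inv] at this
  rw [Finset.sum_congr rfl fun y _ => h3 y, ← avg, avg_const]

/-! ### Characters of symmetric groups -/

theorem IsClassFun.apply_eq {𝕜 : Type*} {n : ℕ} {f : Equiv.Perm (Fin n) → 𝕜} (hf : IsClassFun f)
    {g h : Equiv.Perm (Fin n)} (hgh : IsConj g h) : f g = f h := by
  obtain ⟨c, rfl⟩ := isConj_iff.1 hgh
  exact (hf g c).symm

/-- A permutation and its inverse have the same cycle type. This allows inner products of characters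
to be written without inverses. -/
theorem IsClassFun.apply_inv {𝕜 : Type*} {n : ℕ} {f : Equiv.Perm (Fin n) → 𝕜} (hf : IsClassFun f)
    (g : Equiv.Perm (Fin n)) : f g⁻¹ = f g :=
  hf.apply_eq (Equiv.Perm.isConj_iff_cycleType_eq.2 (Equiv.Perm.cycleType_inv g))

variable {𝕜 : Type*} [Field 𝕜] {n : ℕ}

instance (lam : n.Partition) : Finite (Tabloid lam) :=
  Finite.of_surjective (Tableau.tabloid (lam := lam)) fun ⟨_, T, h⟩ => ⟨T, Subtype.ext h.symm⟩

instance (lam : n.Partition) : FiniteDimensional 𝕜 (SpechtV 𝕜 lam) :=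
  inferInstanceAs (FiniteDimensional 𝕜 (spechtSub 𝕜 lam).toSubmodule)

/-- The character of a Specht module. -/
def chi (𝕜 : Type*) [Field 𝕜] (lam : n.Partition) (g : Equiv.Perm (Fin n)) : 𝕜 :=
  (specht 𝕜 lam).character g

theorem isClassFun_chi (lam : n.Partition) : IsClassFun (chi 𝕜 lam) := fun g h =>
  Representation.char_conj _ g h

theorem isClassFun_sum_chi (d : n.Partition → 𝕜) :
    IsClassFun fun g => ∑ lam, d lam * chi 𝕜 lam g := fun g h =>
  Finset.sum_congr rfl fun lam _ => by rw [isClassFun_chi lam g h]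

variable [IsAlgClosed 𝕜] [CharZero 𝕜]

theorem multiplicity_specht {V : Type*} [AddCommGroup V] [Module 𝕜 V] [FiniteDimensional 𝕜 V]
    (lam : n.Partition) (ρ : Representation 𝕜 (Equiv.Perm (Fin n)) V) :
    (multiplicity (specht 𝕜 lam) ρ : 𝕜) = avg fun g => ρ.character g * chi 𝕜 lam g := by
  rw [multiplicity_eq_sum_character, avg]
  congr 1
  refine Finset.sum_congr rfl fun g _ => ?_
  rw [← (isClassFun_chi lam).apply_inv g, chi]

theorem chi_orthonormal (lam mu : n.Partition) :
    (avg fun g => chi 𝕜 lam g * chi 𝕜 mu g) = if lam = mu then 1 else 0 := by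
  have : (Nat.card (Equiv.Perm (Fin n)) : 𝕜) ≠ 0 := Nat.cast_ne_zero.2 Nat.card_pos.ne'
  let _ : Invertible (Nat.card (Equiv.Perm (Fin n)) : 𝕜) := invertibleOfNonzero this
  have h := Representation.char_orthonormal (specht 𝕜 lam) (specht 𝕜 mu)
  rw [avg]
  refine Eq.trans ?_ (h.trans ?_)
  · congr 1
    refine Finset.sum_congr rfl fun g _ => ?_
    rw [← (isClassFun_chi mu).apply_inv g, chi, chi]
  · by_cases hl : lam = mu
    · subst hl
      rw [if_pos ⟨.refl _⟩, if_pos rfl]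
    · rw [if_neg (fun ⟨e⟩ => hl (eq_of_specht_equiv e).symm), if_neg hl]

/-- Cycle type separates conjugacy classes, so there are at most as many classes as partitions; this
bounds the space of class functions in `sum_avg_mul_chi`. -/
theorem exists_partition_isConj (n : ℕ) :
    ∃ P : Equiv.Perm (Fin n) → n.Partition, ∀ g h, P g = P h ↔ IsConj g h := by
  refine ⟨fun g => ⟨g.partition.parts, g.partition.parts_pos,
    g.partition.parts_sum.trans (Fintype.card_fin n)⟩, fun g h => ?_⟩
  rw [Equiv.Perm.partition_eq_of_isConj, Nat.Partition.ext_iff, Nat.Partition.ext_iff]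

/-- The characters of the Specht modules span the class functions. -/
theorem sum_avg_mul_chi {f : Equiv.Perm (Fin n) → 𝕜} (hf : IsClassFun f)
    (u : Equiv.Perm (Fin n)) :
    ∑ lam : n.Partition, (avg fun x => f x * chi 𝕜 lam x) * chi 𝕜 lam u = f u := by
  obtain ⟨P, hP⟩ := exists_partition_isConj n
  have hfac : ∀ f : Equiv.Perm (Fin n) → 𝕜, IsClassFun f → ∃ c : n.Partition → 𝕜, f = c ∘ P := by
    intro f hf
    refine ⟨Function.extend P f 0, funext fun g => ?_⟩
    have hfa : Function.FactorsThrough f P := fun g h hgh => hf.apply_eq ((hP g h).1 hgh)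
    exact (hfa.extend_apply 0 g).symm
  -- `D` takes the inner products of the class function `c ∘ P` with the Specht characters.
  -- Orthonormality makes it surjective, and as an endomorphism of a finite-dimensional space it is
  -- then injective: a class function is determined by these inner products.
  let D : (n.Partition → 𝕜) →ₗ[𝕜] (n.Partition → 𝕜) :=
    { toFun := fun c lam => avg fun x => c (P x) * chi 𝕜 lam x
      map_add' := fun c d => by
        funext lam
        simp only [avg, Pi.add_apply, add_mul, Finset.sum_add_distrib, mul_add]
      map_smul' := fun a c => by
        funext lam
        simp only [Pi.smul_apply, smul_eq_mul, RingHom.id_apply, mul_avg, mul_assoc] }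
  have hE : ∀ d : n.Partition → 𝕜, ∀ mu,
      (avg fun x => (∑ lam, d lam * chi 𝕜 lam x) * chi 𝕜 mu x) = d mu := by
    intro d mu
    simp only [Finset.sum_mul, mul_assoc]
    rw [← sum_avg]
    simp only [← mul_avg, chi_orthonormal]
    simp
  have hsurj : Function.Surjective D := by
    intro d
    obtain ⟨c, hc⟩ := hfac _ (isClassFun_sum_chi d)
    refine ⟨c, funext fun mu => ?_⟩
    rw [← hE d mu]
    exact congrArg avg (funext fun x => by rw [congrFun hc x]; rfl)
  have hinj : Function.Injective D := LinearMap.injective_iff_surjective.2 hsurj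
  obtain ⟨c, rfl⟩ := hfac f hf
  obtain ⟨c', hc'⟩ := hfac _ (isClassFun_sum_chi (D c))
  have : D c' = D c := by
    funext mu
    rw [← hE (D c) mu]
    exact congrArg avg (funext fun x => by rw [congrFun hc' x]; rfl)
  rw [hinj this] at hc'
  exact congrFun hc' u

/-! ### Classical coefficients as averages -/

theorem kroneckerCoeff_eq_avg (lam mu nu : n.Partition) :
    (kroneckerCoeff 𝕜 lam mu nu : 𝕜) =
      avg fun g => chi 𝕜 lam g * chi 𝕜 mu g * chi 𝕜 nu g := by
  rw [kroneckerCoeff, multiplicity_specht, Representation.char_tensor]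
  rfl

theorem lrCoeff_eq_avg {p q : ℕ} (h : p + q = n) (lam : p.Partition) (mu : q.Partition)
    (nu : n.Partition) :
    (lrCoeff 𝕜 h lam mu nu : 𝕜) =
      avg fun u => avg fun v => chi 𝕜 lam u * chi 𝕜 mu v * chi 𝕜 nu (youngEmb h (u, v)) := by
  have : FiniteDimensional 𝕜 (MonoidAlgebra 𝕜 (Equiv.Perm (Fin n))) :=
    Module.Finite.of_basis (Module.Basis.ofRepr (MonoidAlgebra.coeffLinearEquiv 𝕜))
  rw [lrCoeff, multiplicity_specht, avg_ind_character_mul _ _ (isClassFun_chi nu), avg_prod]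
  refine congrArg avg (funext fun u => congrArg avg (funext fun v => ?_))
  rw [outerTensor, Representation.char_tensor]
  rfl

theorem sum_avg_avg_mul_chi {p q : ℕ} {f : Equiv.Perm (Fin p) × Equiv.Perm (Fin q) → 𝕜}
    (hf : IsClassFun f) (u : Equiv.Perm (Fin p)) (v : Equiv.Perm (Fin q)) :
    ∑ α : p.Partition, ∑ β : q.Partition,
      (avg fun x => avg fun y => chi 𝕜 α x * chi 𝕜 β y * f (x, y)) * (chi 𝕜 α u * chi 𝕜 β v) =
      f (u, v) := by
  have h1 : ∀ x, IsClassFun fun y => f (x, y) := fun x g h => by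
    simpa using hf (x, g) (1, h)
  have h2 : IsClassFun fun x => f (x, v) := fun g h => by
    simpa using hf (g, v) (h, 1)
  rw [← sum_avg_mul_chi h2 u]
  refine Finset.sum_congr rfl fun α _ => ?_
  have h3 : ∀ x, f (x, v) =
      ∑ β : q.Partition, (avg fun y => f (x, y) * chi 𝕜 β y) * chi 𝕜 β v :=
    fun x => (sum_avg_mul_chi (h1 x) v).symm
  simp only [h3, avg_mul, sum_avg, Finset.sum_mul]
  refine congrArg avg (funext fun x => congrArg avg (funext fun y =>
    Finset.sum_congr rfl fun β _ => ?_))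
  ring

end

/-! ### Products of classical coefficients as averages over Young subgroups -/

section

variable {𝕜 : Type*} [Field 𝕜] [IsAlgClosed 𝕜] [CharZero 𝕜]

/-- Transitivity of restriction, in terms of Littlewood-Richardson coefficients. -/
theorem sum_lrCoeff_mul_lrCoeff {a b c m : ℕ} (h : a + b + c = m) (α : a.Partition)
    (ε : b.Partition) (γ : c.Partition) (ν : m.Partition) :
    ∑ κ : (a + b).Partition, (lrCoeff 𝕜 (rfl : a + b = a + b) α ε κ : 𝕜) * lrCoeff 𝕜 h κ γ ν =
      avg fun u => avg fun v => avg fun w => chi 𝕜 α u * chi 𝕜 ε v * (chi 𝕜 γ w *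
        chi 𝕜 ν (youngEmb h (youngEmb rfl (u, v), w))) := by
  have hF : IsClassFun fun x => avg fun w => chi 𝕜 γ w * chi 𝕜 ν (youngEmb h (x, w)) := fun x g =>
    congrArg avg (funext fun w => by
      congr 1
      simpa using (isClassFun_chi (𝕜 := 𝕜) ν).comp (youngEmb h) (x, w) (g, 1))
  have h1 : ∀ κ, (lrCoeff 𝕜 h κ γ ν : 𝕜) =
      avg fun x => (avg fun w => chi 𝕜 γ w * chi 𝕜 ν (youngEmb h (x, w))) * chi 𝕜 κ x := by
    intro κ
    rw [lrCoeff_eq_avg]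
    refine congrArg avg (funext fun x => ?_)
    rw [avg_mul]
    exact congrArg avg (funext fun w => by ring)
  simp only [lrCoeff_eq_avg (rfl : a + b = a + b), avg_mul, sum_avg]
  refine congrArg avg (funext fun u => congrArg avg (funext fun v => ?_))
  rw [← mul_avg, ← sum_avg_mul_chi hF (youngEmb rfl (u, v)), Finset.mul_sum]
  refine Finset.sum_congr rfl fun κ _ => ?_
  rw [h1]
  ring

/-- The Kronecker coefficients are the coordinates of the class function `χ_β χ_δ` in the basis of
the `χ_ε`. -/
theorem sum_kroneckerCoeff_mul {b : ℕ} (β δ : b.Partition) {f : Equiv.Perm (Fin b) → 𝕜} :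
    ∑ ε : b.Partition, (kroneckerCoeff 𝕜 β δ ε : 𝕜) * (avg fun v => chi 𝕜 ε v * f v) =
      avg fun v => chi 𝕜 β v * chi 𝕜 δ v * f v := by
  have hF : IsClassFun fun v => chi 𝕜 β v * chi 𝕜 δ v := fun g h => by
    simp only [isClassFun_chi β g h, isClassFun_chi δ g h]
  simp only [kroneckerCoeff_eq_avg, mul_avg, sum_avg]
  refine congrArg avg (funext fun v => ?_)
  rw [← sum_avg_mul_chi hF v, Finset.sum_mul]
  simp only [mul_assoc]

theorem sum_lrCoeff_mul_chi {p q n : ℕ} (h : p + q = n) (lam : n.Partition)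
    (u : Equiv.Perm (Fin p)) (v : Equiv.Perm (Fin q)) :
    ∑ α : p.Partition, ∑ β : q.Partition,
      (lrCoeff 𝕜 h α β lam : 𝕜) * (chi 𝕜 α u * chi 𝕜 β v) = chi 𝕜 lam (youngEmb h (u, v)) := by
  simp only [lrCoeff_eq_avg]
  exact sum_avg_avg_mul_chi ((isClassFun_chi (𝕜 := 𝕜) lam).comp (youngEmb h)) u v

/-- The sum over `κ` restricts `χ_ν` to `S_a × S_b × S_c`, and the sum over `ε` replaces `χ_ε(v)` by
`χ_β(v) χ_δ(v)`. The sums over `α, β` and over `γ, δ` then reassemble the restrictions of `χ_λ` and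
`χ_μ`, both evaluated at the same `v`. -/
theorem sum_coeffs_eq_avg {a b c k l m : ℕ} (h₁ : a + b = k) (h₂ : c + b = l) (h₃ : a + b + c = m)
    (lam : k.Partition) (mu : l.Partition) (nu : m.Partition) :
    ((∑ α : a.Partition, ∑ β : b.Partition, ∑ γ : c.Partition, ∑ δ : b.Partition,
          ∑ ε : b.Partition, ∑ κ : (a + b).Partition,
            lrCoeff 𝕜 h₁ α β lam * lrCoeff 𝕜 h₂ γ δ mu * kroneckerCoeff 𝕜 β δ ε *
            lrCoeff 𝕜 (rfl : a + b = a + b) α ε κ * lrCoeff 𝕜 h₃ κ γ nu : ℕ) : 𝕜) =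
      avg fun u => avg fun v => avg fun w => chi 𝕜 lam (youngEmb h₁ (u, v)) *
        chi 𝕜 mu (youngEmb h₂ (w, v)) * chi 𝕜 nu (youngEmb h₃ (youngEmb rfl (u, v), w)) := by
  push_cast
  have h1 : ∀ (α : a.Partition) (β δ : b.Partition) (γ : c.Partition),
      ∑ ε : b.Partition, (kroneckerCoeff 𝕜 β δ ε : 𝕜) * ∑ κ : (a + b).Partition,
        (lrCoeff 𝕜 (rfl : a + b = a + b) α ε κ : 𝕜) * lrCoeff 𝕜 h₃ κ γ nu =
      avg fun u => avg fun v => avg fun w => (chi 𝕜 α u * chi 𝕜 β v) *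
        (chi 𝕜 γ w * chi 𝕜 δ v) * chi 𝕜 nu (youngEmb h₃ (youngEmb rfl (u, v), w)) := by
    intro α β δ γ
    have h2 : ∀ ε : b.Partition, (∑ κ : (a + b).Partition,
        (lrCoeff 𝕜 (rfl : a + b = a + b) α ε κ : 𝕜) * lrCoeff 𝕜 h₃ κ γ nu) =
        avg fun v => chi 𝕜 ε v * (avg fun u => avg fun w => chi 𝕜 α u * (chi 𝕜 γ w *
          chi 𝕜 nu (youngEmb h₃ (youngEmb rfl (u, v), w)))) := by
      intro ε
      rw [sum_lrCoeff_mul_lrCoeff, avg_comm]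
      simp only [mul_avg]
      refine congrArg avg (funext fun v => congrArg avg (funext fun u =>
        congrArg avg (funext fun w => ?_)))
      ring
    simp only [h2]
    rw [sum_kroneckerCoeff_mul]
    simp only [mul_avg]
    rw [avg_comm]
    refine congrArg avg (funext fun v => congrArg avg (funext fun u =>
      congrArg avg (funext fun w => ?_)))
    ring
  simp only [mul_assoc, ← Finset.mul_sum]
  simp only [h1, mul_avg, sum_avg]
  refine congrArg avg (funext fun u => congrArg avg (funext fun v =>
    congrArg avg (funext fun w => ?_)))
  rw [← sum_lrCoeff_mul_chi h₁, ← sum_lrCoeff_mul_chi h₂, Finset.sum_mul]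
  refine Finset.sum_congr rfl fun α _ => ?_
  rw [Finset.sum_mul]
  refine Finset.sum_congr rfl fun β _ => ?_
  rw [Finset.sum_mul, Finset.mul_sum, Finset.mul_sum]
  refine Finset.sum_congr rfl fun γ _ => ?_
  rw [Finset.sum_mul, Finset.mul_sum, Finset.mul_sum]
  refine Finset.sum_congr rfl fun δ _ => ?_
  ring

end

section

/-! ### Coinvariants of tensor products -/

section

variable {R G A B S : Type*} [CommRing R] [Group G] [AddCommGroup A] [Module R A] [AddCommGroup B]
  [Module R B] [AddCommGroup S] [Module R S] (ρ : Representation R G A) (σ : Representation R G B)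

/-- The canonical projection of a tensor product onto its coinvariants. -/
def tensorMk : A ⊗[R] B →ₗ[R] Representation.Coinvariants (V := A ⊗[R] B) (ρ.tprod σ) :=
  Representation.Coinvariants.mk (V := A ⊗[R] B) (ρ.tprod σ)

theorem tensorMk_surjective : Function.Surjective (tensorMk ρ σ) :=
  Representation.Coinvariants.mk_surjective (V := A ⊗[R] B) (ρ.tprod σ)

theorem tensorMk_self (g : G) (x : A ⊗[R] B) :
    tensorMk ρ σ (ρ.tprod σ g x) = tensorMk ρ σ x :=
  Representation.Coinvariants.mk_self_apply (V := A ⊗[R] B) (ρ.tprod σ) g x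

theorem exists_tensorMk_factor (F : A ⊗[R] B →ₗ[R] S) (hF : ∀ g, F ∘ₗ ρ.tprod σ g = F) :
    ∃ F' : Representation.Coinvariants (V := A ⊗[R] B) (ρ.tprod σ) →ₗ[R] S,
      ∀ x, F' (tensorMk ρ σ x) = F x :=
  ⟨Representation.Coinvariants.lift (V := A ⊗[R] B) (ρ.tprod σ) F hF, fun _ => rfl⟩

end

theorem trace_tensorCoinvariants_map {𝕜 G A B : Type*} [Field 𝕜] [CharZero 𝕜] [Group G]
    [Fintype G] [AddCommGroup A] [Module 𝕜 A] [FiniteDimensional 𝕜 A] [AddCommGroup B] [Module 𝕜 B]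
    [FiniteDimensional 𝕜 B] (ρ : Representation 𝕜 G A) (σ : Representation 𝕜 G B) (T : A →ₗ[𝕜] A)
    (hT : ∀ g, T.rTensor B ∘ₗ ρ.tprod σ g = ρ.tprod σ g ∘ₗ T.rTensor B) :
    LinearMap.trace 𝕜 _ (Representation.Coinvariants.map (V := A ⊗[𝕜] B) (W := A ⊗[𝕜] B)
      (ρ.tprod σ) (ρ.tprod σ) ⟨T.rTensor B, hT⟩) =
      (Nat.card G : 𝕜)⁻¹ * ∑ g, LinearMap.trace 𝕜 A (T ∘ₗ ρ g) * LinearMap.trace 𝕜 B (σ g) := by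
  refine (trace_coinvariants_map (W := A ⊗[𝕜] B) (ρ.tprod σ) ⟨T.rTensor B, hT⟩).trans ?_
  congr 1
  refine Finset.sum_congr rfl fun g _ => ?_
  have h1 : T.rTensor B ∘ₗ ρ.tprod σ g = TensorProduct.map (T ∘ₗ ρ g) (σ g) :=
    TensorProduct.ext' fun x v => rfl
  exact (congrArg _ h1).trans (LinearMap.trace_tensorProduct' _ _)

/-! ### Cells and the characters of the cell modules -/

variable {n k : ℕ}

theorem IS.ext {f g : IS n} (h : ∀ x, PEquiv.toFun f x = PEquiv.toFun g x) : f = g :=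
  PEquiv.ext h

theorem IS.toFun_injective (f : IS n) {x y z : Fin n} (hx : PEquiv.toFun f x = some z)
    (hy : PEquiv.toFun f y = some z) : x = y :=
  PEquiv.inj f hx hy

theorem IS.mem_dom_iff {f : IS n} {x : Fin n} : x ∈ f.dom ↔ ∃ y, PEquiv.toFun f x = some y :=
  Option.isSome_iff_exists

theorem groupElt_toFun (h : k ≤ n) (g : Equiv.Perm (Fin k)) (i : Fin k) :
    PEquiv.toFun (groupElt h g) (Fin.castLE h i) = some (Fin.castLE h (g i)) := by
  simp [groupElt]

theorem groupElt_toFun_of_not_lt (h : k ≤ n) (g : Equiv.Perm (Fin k)) {x : Fin n}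
    (hx : ¬ x.val < k) :
    PEquiv.toFun (groupElt h g) x = none := by
  simp [groupElt, hx]

theorem Cell.toFun_of_not_lt (p : Cell n k) {x : Fin n} (hx : ¬ x.val < k) :
    PEquiv.toFun p.1 x = none := by
  have : x ∉ p.1.dom := by rw [p.2]; exact hx
  rw [IS.mem_dom_iff] at this
  rcases h : PEquiv.toFun p.1 x with _ | y
  · rfl
  · exact absurd ⟨y, h⟩ this

theorem Cell.isSome (h : k ≤ n) (p : Cell n k) (i : Fin k) :
    (PEquiv.toFun p.1 (Fin.castLE h i)).isSome := by
  have : Fin.castLE h i ∈ p.1.dom := by rw [p.2]; exact i.2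
  exact this

/-- The value of an element of the cell at one of the first `k` elements. -/
def Cell.val (h : k ≤ n) (p : Cell n k) (i : Fin k) : Fin n :=
  (PEquiv.toFun p.1 (Fin.castLE h i)).get (p.isSome h i)

theorem Cell.toFun_castLE (h : k ≤ n) (p : Cell n k) (i : Fin k) :
    PEquiv.toFun p.1 (Fin.castLE h i) = some (p.val h i) :=
  (Option.some_get _).symm

theorem Cell.val_injective (h : k ≤ n) (p : Cell n k) : Function.Injective (p.val h) := by
  intro i j hij
  have h1 := p.toFun_castLE h i
  have h2 := p.toFun_castLE h j
  rw [← hij] at h2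
  exact Fin.castLE_injective h (IS.toFun_injective p.1 h1 h2)

theorem exists_castLE (h : k ≤ n) {x : Fin n} (hx : x.val < k) : ∃ i, Fin.castLE h i = x :=
  ⟨⟨x, hx⟩, rfl⟩

theorem IS.eq_cell_iff (h : k ≤ n) (f : IS n) (p : Cell n k) :
    f = p.1 ↔ (∀ x : Fin n, ¬ x.val < k → PEquiv.toFun f x = none) ∧
      ∀ i, PEquiv.toFun f (Fin.castLE h i) = some (p.val h i) := by
  constructor
  · rintro rfl
    exact ⟨fun x hx => p.toFun_of_not_lt hx, p.toFun_castLE h⟩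
  · rintro ⟨h1, h2⟩
    refine IS.ext fun x => ?_
    by_cases hx : x.val < k
    · obtain ⟨i, rfl⟩ := exists_castLE h hx
      rw [h2, p.toFun_castLE]
    · rw [h1 x hx, p.toFun_of_not_lt hx]

/-- The partial bijection with domain the first `k` elements that is given by an embedding. -/
def ofEmbedding (h : k ≤ n) (e : Fin k ↪ Fin n) : IS n where
  toFun x := if hx : x.val < k then some (e ⟨x, hx⟩) else none
  invFun y := by
    classical
    exact if hy : ∃ i, e i = y then some (Fin.castLE h hy.choose) else none
  inv x y := by
    classical
    constructor
    · intro hy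
      split_ifs at hy with h1
      obtain rfl := Option.some.inj hy
      have hx : (Fin.castLE h h1.choose).val < k := h1.choose.2
      rw [dif_pos hx]
      exact congrArg some h1.choose_spec
    · intro hx
      split_ifs at hx with h1
      obtain rfl := Option.some.inj hx
      have h2 : ∃ i, e i = e ⟨x, h1⟩ := ⟨_, rfl⟩
      rw [dif_pos h2, e.injective h2.choose_spec]
      rfl

theorem ofEmbedding_castLE (h : k ≤ n) (e : Fin k ↪ Fin n) (i : Fin k) :
    PEquiv.toFun (ofEmbedding h e) (Fin.castLE h i) = some (e i) := by
  simp [ofEmbedding]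

theorem ofEmbedding_of_not_lt (h : k ≤ n) (e : Fin k ↪ Fin n) {x : Fin n} (hx : ¬ x.val < k) :
    PEquiv.toFun (ofEmbedding h e) x = none := by
  simp [ofEmbedding, hx]

theorem ofEmbedding_dom (h : k ≤ n) (e : Fin k ↪ Fin n) :
    (ofEmbedding h e).dom = {x : Fin n | x.val < k} := by
  ext x
  rw [IS.mem_dom_iff]
  by_cases hx : x.val < k
  · obtain ⟨i, rfl⟩ := exists_castLE h hx
    exact ⟨fun _ => hx, fun _ => ⟨_, ofEmbedding_castLE h e i⟩⟩
  · constructor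
    · rintro ⟨y, hy⟩
      rw [ofEmbedding_of_not_lt h e hx] at hy
      cases hy
    · exact fun h' => absurd h' hx

/-- The left cell consists of the embeddings of the first `k` elements. -/
def cellEquiv (h : k ≤ n) : Cell n k ≃ (Fin k ↪ Fin n) where
  toFun p := ⟨p.val h, p.val_injective h⟩
  invFun e := ⟨ofEmbedding h e, ofEmbedding_dom h e⟩
  left_inv p := Subtype.ext ((IS.eq_cell_iff h _ p).2
    ⟨fun _ hx => ofEmbedding_of_not_lt h _ hx, fun i => ofEmbedding_castLE h _ i⟩)
  right_inv e := by
    ext i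
    have h1 := Cell.toFun_castLE h ⟨ofEmbedding h e, ofEmbedding_dom h e⟩ i
    rw [ofEmbedding_castLE] at h1
    exact congrArg Fin.val (Option.some.inj h1).symm

theorem cellEquiv_apply (h : k ≤ n) (p : Cell n k) (i : Fin k) : cellEquiv h p i = p.val h i := rfl

theorem finite_cell (h : k ≤ n) : Finite (Cell n k) := Finite.of_equiv _ (cellEquiv h).symm

theorem rmul_toFun_castLE (h : k ≤ n) (p : Cell n k) (g : Equiv.Perm (Fin k)) (i : Fin k) :
    PEquiv.toFun (p.rmul h g).1 (Fin.castLE h i) = some (p.val h (g i)) := by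
  rw [Cell.rmul, IS.mul_toFun, groupElt_toFun, Option.bind_some, p.toFun_castLE]

theorem mul_toFun_castLE (h : k ≤ n) (p : Cell n k) (σ : IS n) (i : Fin k) :
    PEquiv.toFun (σ * p.1) (Fin.castLE h i) = PEquiv.toFun σ (p.val h i) := by
  rw [IS.mul_toFun, p.toFun_castLE, Option.bind_some]

theorem mul_toFun_of_not_lt (p : Cell n k) (σ : IS n) {x : Fin n} (hx : ¬ x.val < k) :
    PEquiv.toFun (σ * p.1) x = none := by
  rw [IS.mul_toFun, p.toFun_of_not_lt hx, Option.bind_none]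

theorem mul_dom_eq_iff (h : k ≤ n) (p : Cell n k) (σ : IS n) :
    (σ * p.1).dom = {x : Fin n | x.val < k} ↔ ∀ i, p.val h i ∈ σ.dom := by
  constructor
  · intro hd i
    have : Fin.castLE h i ∈ (σ * p.1).dom := by rw [hd]; exact i.2
    rw [IS.mem_dom_iff, mul_toFun_castLE] at this
    exact IS.mem_dom_iff.2 this
  · intro hd
    refine ((IS.dom_mul_subset _ _).trans p.2.le).antisymm fun x hx => ?_
    obtain ⟨i, rfl⟩ := exists_castLE h hx
    rw [IS.mem_dom_iff, mul_toFun_castLE]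
    exact IS.mem_dom_iff.1 (hd i)

theorem mul_rmul_eq_iff (h : k ≤ n) (p : Cell n k) (σ : IS n) (g : Equiv.Perm (Fin k)) :
    σ * (p.rmul h g⁻¹).1 = p.1 ↔
      ∀ i, PEquiv.toFun σ (cellEquiv h p i) = some (cellEquiv h p (g i)) := by
  rw [IS.eq_cell_iff h]
  have h1 : ∀ i, PEquiv.toFun (σ * (p.rmul h g⁻¹).1) (Fin.castLE h i) =
      PEquiv.toFun σ (p.val h (g⁻¹ i)) := fun i => by
    rw [IS.mul_toFun, rmul_toFun_castLE, Option.bind_some]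
  constructor
  · rintro ⟨-, h2⟩ i
    have h3 := h2 (g i)
    rw [h1, show g⁻¹ (g i) = i from Equiv.symm_apply_apply g i] at h3
    exact h3
  · intro h2
    refine ⟨fun x hx => mul_toFun_of_not_lt _ σ hx, fun i => ?_⟩
    have h3 := h2 (g⁻¹ i)
    rw [show g (g⁻¹ i) = i from Equiv.apply_symm_apply g i] at h3
    rw [h1]
    exact h3

variable {𝕜 : Type*} [Field 𝕜]

theorem cellRep_single (σ : IS n) (p : Cell n k) :
    cellRep 𝕜 n k σ (Finsupp.single p 1) = cellAct 𝕜 σ p := by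
  simp [cellRep]

theorem cellRightRep_single (h : k ≤ n) (g : Equiv.Perm (Fin k)) (p : Cell n k) (a : 𝕜) :
    cellRightRep 𝕜 h g (Finsupp.single p a) = Finsupp.single (p.rmul h g⁻¹) a :=
  Finsupp.mapDomain_single

open Classical in
theorem cellAct_apply (σ : IS n) (p q : Cell n k) :
    cellAct 𝕜 σ p q = if σ * p.1 = q.1 then 1 else 0 := by
  rw [cellAct]
  split_ifs with h1 h2 h2
  · rw [Finsupp.single_apply, if_pos (Subtype.ext h2)]
  · rw [Finsupp.single_apply, if_neg fun h3 => h2 (congrArg Subtype.val h3)]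
  · exact absurd (h2 ▸ q.2) h1
  · rfl

/-- In the basis of cell elements the diagonal entry at `p` is one exactly when `σ p g⁻¹ = p`, that
is, when `σ p = p g` as maps on the first `k` points. -/
theorem trace_cellRep_comp_cellRightRep (h : k ≤ n) (σ : IS n) (g : Equiv.Perm (Fin k)) :
    LinearMap.trace 𝕜 _ (cellRep 𝕜 n k σ ∘ₗ cellRightRep 𝕜 h g) =
      (Nat.card {p : Fin k ↪ Fin n // ∀ i, PEquiv.toFun σ (p i) = some (p (g i))} : 𝕜) := by
  classical
  have := finite_cell h
  let _ := Fintype.ofFinite (Cell n k)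
  rw [trace_eq_sum_repr Finsupp.basisSingleOne]
  simp only [Finsupp.coe_basisSingleOne, LinearMap.comp_apply, cellRightRep_single, cellRep_single,
    Finsupp.basisSingleOne_repr, LinearEquiv.refl_apply, cellAct_apply, mul_rmul_eq_iff h]
  rw [Finset.sum_boole, ← Fintype.card_subtype, ← Nat.card_eq_fintype_card]
  congr 1
  exact Nat.card_congr ((cellEquiv h).subtypeEquiv fun p => Iff.rfl)

/-- The canonical projection onto `N^lam`. -/
def nvMk (h : k ≤ n) (lam : k.Partition) :
    (Cell n k →₀ 𝕜) ⊗[𝕜] SpechtV 𝕜 lam →ₗ[𝕜] NV 𝕜 h lam :=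
  tensorMk (cellRightRep 𝕜 h) (specht 𝕜 lam)

theorem nvMk_surjective (h : k ≤ n) (lam : k.Partition) :
    Function.Surjective (nvMk (𝕜 := 𝕜) h lam) :=
  tensorMk_surjective (cellRightRep 𝕜 h) (specht 𝕜 lam)

theorem exists_nvMk_factor {S : Type*} [AddCommGroup S] [Module 𝕜 S] (h : k ≤ n)
    (lam : k.Partition) (F : (Cell n k →₀ 𝕜) ⊗[𝕜] SpechtV 𝕜 lam →ₗ[𝕜] S)
    (hF : ∀ g, F ∘ₗ (cellRightRep 𝕜 h).tprod (specht 𝕜 lam) g = F) :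
    ∃ F' : NV 𝕜 h lam →ₗ[𝕜] S, ∀ x, F' (nvMk h lam x) = F x :=
  exists_tensorMk_factor (cellRightRep 𝕜 h) (specht 𝕜 lam) F hF

theorem nvMk_self (h : k ≤ n) (lam : k.Partition) (g : Equiv.Perm (Fin k))
    (x : (Cell n k →₀ 𝕜) ⊗[𝕜] SpechtV 𝕜 lam) :
    nvMk h lam ((cellRightRep 𝕜 h).tprod (specht 𝕜 lam) g x) = nvMk h lam x :=
  tensorMk_self (cellRightRep 𝕜 h) (specht 𝕜 lam) g x

/-- The class of `p ⊗ v` in `N^lam`. -/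
def nv (h : k ≤ n) (lam : k.Partition) (p : Cell n k) : SpechtV 𝕜 lam →ₗ[𝕜] NV 𝕜 h lam :=
  nvMk h lam ∘ₗ TensorProduct.mk 𝕜 (Cell n k →₀ 𝕜) (SpechtV 𝕜 lam) (Finsupp.single p 1)

theorem nv_apply (h : k ≤ n) (lam : k.Partition) (p : Cell n k) (v : SpechtV 𝕜 lam) :
    nv h lam p v = nvMk h lam (Finsupp.single p 1 ⊗ₜ v) := rfl

theorem nv_induction (h : k ≤ n) (lam : k.Partition) {P : NV 𝕜 h lam → Prop} (w : NV 𝕜 h lam)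
    (h0 : P 0) (hadd : ∀ x y, P x → P y → P (x + y)) (hnv : ∀ p v, P (nv h lam p v)) : P w := by
  obtain ⟨w, rfl⟩ := nvMk_surjective h lam w
  induction w using TensorProduct.induction_on with
  | zero => rwa [map_zero]
  | add x y hx hy => rw [map_add]; exact hadd _ _ hx hy
  | tmul x v =>
    induction x using Finsupp.induction_linear with
    | zero => rwa [TensorProduct.zero_tmul, map_zero]
    | add x y hx hy => rw [TensorProduct.add_tmul, map_add]; exact hadd _ _ hx hy
    | single p a =>
      have : (Finsupp.single p a ⊗ₜ[𝕜] v : (Cell n k →₀ 𝕜) ⊗[𝕜] SpechtV 𝕜 lam) =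
          Finsupp.single p 1 ⊗ₜ (a • v) := by
        rw [← TensorProduct.smul_tmul, Finsupp.smul_single, smul_eq_mul, mul_one]
      rw [this]
      exact hnv p _

theorem N_nvMk (h : k ≤ n) (lam : k.Partition) (σ : IS n)
    (x : (Cell n k →₀ 𝕜) ⊗[𝕜] SpechtV 𝕜 lam) :
    N 𝕜 h lam σ (nvMk h lam x) =
      nvMk h lam ((cellRep 𝕜 n k σ).rTensor (SpechtV 𝕜 lam) x) := rfl

theorem N_nv_of_dom (h : k ≤ n) (lam : k.Partition) (σ : IS n) (p : Cell n k) (v : SpechtV 𝕜 lam)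
    (hd : (σ * p.1).dom = {x : Fin n | x.val < k}) :
    N 𝕜 h lam σ (nv h lam p v) = nv h lam ⟨σ * p.1, hd⟩ v := by
  rw [nv_apply, N_nvMk, LinearMap.rTensor_tmul, cellRep_single, cellAct, dif_pos hd, nv_apply]

theorem N_nv_of_not_dom (h : k ≤ n) (lam : k.Partition) (σ : IS n) (p : Cell n k)
    (v : SpechtV 𝕜 lam) (hd : ¬ (σ * p.1).dom = {x : Fin n | x.val < k}) :
    N 𝕜 h lam σ (nv h lam p v) = 0 := by
  rw [nv_apply, N_nvMk, LinearMap.rTensor_tmul, cellRep_single, cellAct, dif_neg hd,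
    TensorProduct.zero_tmul, map_zero]

theorem rmul_rmul_inv (h : k ≤ n) (p : Cell n k) (g : Equiv.Perm (Fin k)) :
    (p.rmul h g).rmul h g⁻¹ = p := by
  refine Subtype.ext ?_
  change p.1 * groupElt h g * groupElt h g⁻¹ = p.1
  rw [mul_assoc, ← groupElt_mul, mul_inv_cancel, mul_groupElt_one]

theorem nv_rmul (h : k ≤ n) (lam : k.Partition) (p : Cell n k) (g : Equiv.Perm (Fin k))
    (v : SpechtV 𝕜 lam) : nv h lam (p.rmul h g) v = nv h lam p (specht 𝕜 lam g v) := by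
  rw [nv_apply, ← nvMk_self h lam g, Representation.tprod_apply, TensorProduct.map_tmul,
    cellRightRep_single, rmul_rmul_inv, nv_apply]

theorem exists_nv_lift {S : Type*} [AddCommGroup S] [Module 𝕜 S] (h : k ≤ n) (lam : k.Partition)
    (f : Cell n k → SpechtV 𝕜 lam →ₗ[𝕜] S)
    (hf : ∀ p g v, f (p.rmul h g) v = f p (specht 𝕜 lam g v)) :
    ∃ F : NV 𝕜 h lam →ₗ[𝕜] S, ∀ p v, F (nv h lam p v) = f p v := by
  let F0 : (Cell n k →₀ 𝕜) ⊗[𝕜] SpechtV 𝕜 lam →ₗ[𝕜] S :=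
    TensorProduct.lift (Finsupp.linearCombination 𝕜 f)
  have hF0 : ∀ p v, F0 (Finsupp.single p 1 ⊗ₜ v) = f p v := fun p v => by
    simp [F0]
  obtain ⟨F, hF⟩ := exists_nvMk_factor h lam F0 fun g => by
    ext p v
    change F0 (TensorProduct.map (cellRightRep 𝕜 h g) (specht 𝕜 lam g)
      (Finsupp.single p 1 ⊗ₜ v)) = F0 (Finsupp.single p 1 ⊗ₜ v)
    rw [TensorProduct.map_tmul, cellRightRep_single, hF0, hF0, ← hf]
    congr 2
    have := rmul_rmul_inv h p g⁻¹
    rwa [inv_inv] at this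
  exact ⟨F, fun p v => by rw [nv_apply, hF, hF0]⟩

theorem finiteDimensional_tensor (h : k ≤ n) (lam : k.Partition) :
    FiniteDimensional 𝕜 ((Cell n k →₀ 𝕜) ⊗[𝕜] SpechtV 𝕜 lam) := by
  have := finite_cell h
  have : FiniteDimensional 𝕜 (Cell n k →₀ 𝕜) := inferInstance
  exact Module.Finite.tensorProduct 𝕜 _ _

instance (h : k ≤ n) (lam : k.Partition) : FiniteDimensional 𝕜 (NV 𝕜 h lam) :=
  have := finiteDimensional_tensor (𝕜 := 𝕜) h lam
  Module.Finite.of_surjective (nvMk h lam) (nvMk_surjective h lam)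

variable [CharZero 𝕜]

theorem N_character (h : k ≤ n) (lam : k.Partition) (σ : IS n) :
    (N 𝕜 h lam).character σ = avg fun g =>
      (Nat.card {p : Fin k ↪ Fin n // ∀ i, PEquiv.toFun σ (p i) = some (p (g i))} : 𝕜) *
        chi 𝕜 lam g := by
  have := finite_cell h
  have : FiniteDimensional 𝕜 (Cell n k →₀ 𝕜) := inferInstance
  refine (trace_tensorCoinvariants_map (cellRightRep 𝕜 h) (specht 𝕜 lam) (cellRep 𝕜 n k σ)
    _).trans ?_
  rw [avg]
  congr 1
  refine Finset.sum_congr rfl fun g _ => ?_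
  rw [trace_cellRep_comp_cellRightRep, chi, Representation.character]

end

section

/-! ### Idempotents of the symmetric inverse semigroup -/

section Idempotents

variable {n m : ℕ}

/-- The inverse of a partial bijection. -/
def IS.inverse (f : IS n) : IS n := PEquiv.symm f

theorem IS.inverse_toFun_iff (f : IS n) (x y : Fin n) :
    PEquiv.toFun f.inverse y = some x ↔ PEquiv.toFun f x = some y :=
  PEquiv.eq_some_iff f

theorem Cell.inverse_val (h : m ≤ n) (p : Cell n m) (i : Fin m) :
    PEquiv.toFun p.1.inverse (p.val h i) = some (Fin.castLE h i) :=
  (IS.inverse_toFun_iff _ _ _).2 (p.toFun_castLE h i)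

theorem Cell.mem_range_of_inverse (h : m ≤ n) (p : Cell n m) {x y : Fin n}
    (hxy : PEquiv.toFun p.1.inverse y = some x) : ∃ i, Fin.castLE h i = x ∧ p.val h i = y := by
  rw [IS.inverse_toFun_iff] at hxy
  by_cases hx : x.val < m
  · obtain ⟨i, rfl⟩ := exists_castLE h hx
    rw [p.toFun_castLE] at hxy
    exact ⟨i, rfl, Option.some.inj hxy⟩
  · rw [p.toFun_of_not_lt hx] at hxy
    cases hxy

theorem Cell.mem_dom_inverse (h : m ≤ n) (p : Cell n m) (y : Fin n) :
    y ∈ p.1.inverse.dom ↔ y ∈ Set.range (p.val h) := by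
  rw [IS.mem_dom_iff]
  constructor
  · rintro ⟨x, hx⟩
    obtain ⟨i, -, hi⟩ := p.mem_range_of_inverse h hx
    exact ⟨i, hi⟩
  · rintro ⟨i, rfl⟩
    exact ⟨_, p.inverse_val h i⟩

theorem Cell.mul_inverse_toFun (h : m ≤ n) (p : Cell n m) (i : Fin m) :
    PEquiv.toFun (p.1 * p.1.inverse) (p.val h i) = some (p.val h i) := by
  rw [IS.mul_toFun, p.inverse_val, Option.bind_some, p.toFun_castLE]

theorem Cell.mem_dom_mul_inverse (h : m ≤ n) (p : Cell n m) (y : Fin n) :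
    y ∈ (p.1 * p.1.inverse).dom ↔ y ∈ Set.range (p.val h) := by
  constructor
  · exact fun hy => (p.mem_dom_inverse h y).1 (IS.dom_mul_subset _ _ hy)
  · rintro ⟨i, rfl⟩
    exact IS.mem_dom_iff.2 ⟨_, p.mul_inverse_toFun h i⟩

/-- The identity of the maximal subgroup, as an element of the cell. -/
def Cell.base (h : m ≤ n) : Cell n m :=
  (cellEquiv h).symm ⟨Fin.castLE h, Fin.castLE_injective h⟩

theorem Cell.base_val (h : m ≤ n) (i : Fin m) : (Cell.base h).val h i = Fin.castLE h i := by
  rw [← cellEquiv_apply, Cell.base, Equiv.apply_symm_apply]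
  rfl

theorem groupElt_eq_base_rmul (h : m ≤ n) (g : Equiv.Perm (Fin m)) :
    groupElt h g = ((Cell.base h).rmul h g).1 := by
  refine IS.ext fun x => ?_
  by_cases hx : x.val < m
  · obtain ⟨i, rfl⟩ := exists_castLE h hx
    rw [groupElt_toFun, rmul_toFun_castLE, Cell.base_val]
  · rw [groupElt_toFun_of_not_lt h g hx, Cell.toFun_of_not_lt _ hx]

theorem base_eq_groupElt_one (h : m ≤ n) : (Cell.base h).1 = groupElt h 1 := by
  rw [groupElt_eq_base_rmul]
  exact (mul_groupElt_one h _).symm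

theorem Cell.mul_base (h : m ≤ n) (p : Cell n m) : p.1 * (Cell.base h).1 = p.1 := by
  rw [base_eq_groupElt_one, mul_groupElt_one]

theorem exists_base_rmul_eq (h : m ≤ n) (p : Cell n m) (hp : ∀ i, (p.val h i).val < m) :
    ∃ g, p = (Cell.base h).rmul h g := by
  choose f hf using fun i => exists_castLE h (hp i)
  have hinj : Function.Injective f := fun i j hij => p.val_injective h (by rw [← hf, ← hf, hij])
  refine ⟨Equiv.ofBijective f (Finite.injective_iff_bijective.1 hinj), Subtype.ext ?_⟩
  rw [← groupElt_eq_base_rmul, eq_comm, IS.eq_cell_iff h]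
  refine ⟨fun x hx => groupElt_toFun_of_not_lt h _ hx, fun i => ?_⟩
  rw [groupElt_toFun, ← hf]
  rfl

open Classical in
/-- The idempotent on the complement of `T` in the first `m` elements. -/
def complIdem (h : m ≤ n) (T : Finset (Fin m)) : IS n :=
  PEquiv.ofSet {x | ∃ i, i ∉ T ∧ Fin.castLE h i = x}

theorem complIdem_toFun_of_mem (h : m ≤ n) {T : Finset (Fin m)} {i : Fin m} (hi : i ∈ T) :
    PEquiv.toFun (complIdem h T) (Fin.castLE h i) = none := by
  refine if_neg ?_
  rintro ⟨j, hj, hij⟩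
  exact hj (Fin.castLE_injective h hij ▸ hi)

theorem complIdem_toFun_of_notMem (h : m ≤ n) {T : Finset (Fin m)} {i : Fin m} (hi : i ∉ T) :
    PEquiv.toFun (complIdem h T) (Fin.castLE h i) = some (Fin.castLE h i) :=
  if_pos ⟨i, hi, rfl⟩

theorem complIdem_toFun_of_not_lt (h : m ≤ n) (T : Finset (Fin m)) {x : Fin n}
    (hx : ¬ x.val < m) : PEquiv.toFun (complIdem h T) x = none := by
  refine if_neg ?_
  rintro ⟨j, -, rfl⟩
  exact hx j.2

theorem complIdem_mul (h : m ≤ n) (S T : Finset (Fin m)) :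
    complIdem h S * complIdem h T = complIdem h (S ∪ T) := by
  refine IS.ext fun x => ?_
  rw [IS.mul_toFun]
  by_cases hx : x.val < m
  · obtain ⟨i, rfl⟩ := exists_castLE h hx
    by_cases hT : i ∈ T
    · rw [complIdem_toFun_of_mem h hT, complIdem_toFun_of_mem h (Finset.mem_union_right _ hT)]
      rfl
    · rw [complIdem_toFun_of_notMem h hT, Option.bind_some]
      by_cases hS : i ∈ S
      · rw [complIdem_toFun_of_mem h hS, complIdem_toFun_of_mem h (Finset.mem_union_left _ hS)]
      · rw [complIdem_toFun_of_notMem h hS,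
          complIdem_toFun_of_notMem h (by simp [hS, hT])]
  · rw [complIdem_toFun_of_not_lt h _ hx, complIdem_toFun_of_not_lt h _ hx]
    rfl

theorem groupElt_mul_complIdem (h : m ≤ n) (g : Equiv.Perm (Fin m)) (T : Finset (Fin m)) :
    groupElt h g * complIdem h T = complIdem h (T.map g.toEmbedding) * groupElt h g := by
  refine IS.ext fun x => ?_
  rw [IS.mul_toFun, IS.mul_toFun]
  by_cases hx : x.val < m
  · obtain ⟨i, rfl⟩ := exists_castLE h hx
    rw [groupElt_toFun, Option.bind_some]
    by_cases hT : i ∈ T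
    · rw [complIdem_toFun_of_mem h hT, complIdem_toFun_of_mem h (by simpa using hT)]
      rfl
    · rw [complIdem_toFun_of_notMem h hT, Option.bind_some, groupElt_toFun,
        complIdem_toFun_of_notMem h (by simpa using hT)]
  · rw [complIdem_toFun_of_not_lt h _ hx, groupElt_toFun_of_not_lt h _ hx]
    rfl

/-- Some `j` lies outside the domain of `σ p`, and deleting it beforehand changes nothing. This
turns the zero products of the cell module into products with an idempotent. -/
theorem exists_mul_complIdem_eq (h : m ≤ n) (p : Cell n m) (σ : IS n)
    (hd : ¬ (σ * p.1).dom = {x : Fin n | x.val < m}) :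
    ∃ j, σ * p.1 * complIdem h {j} = σ * p.1 := by
  rw [mul_dom_eq_iff h, not_forall] at hd
  obtain ⟨j, hj⟩ := hd
  refine ⟨j, IS.ext fun x => ?_⟩
  rw [IS.mul_toFun]
  by_cases hx : x.val < m
  · obtain ⟨i, rfl⟩ := exists_castLE h hx
    by_cases hi : i ∈ ({j} : Finset (Fin m))
    · rw [complIdem_toFun_of_mem h hi, mul_toFun_castLE, Finset.mem_singleton.1 hi]
      rw [IS.mem_dom_iff] at hj
      rcases hy : PEquiv.toFun σ (p.val h j) with _ | y
      · rfl
      · exact absurd ⟨y, hy⟩ hj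
    · rw [complIdem_toFun_of_notMem h hi, Option.bind_some]
  · rw [complIdem_toFun_of_not_lt h _ hx, mul_toFun_of_not_lt p σ hx]
    rfl

theorem complIdem_mul_groupElt_toFun_iff (h : m ≤ n) (T : Finset (Fin m))
    (g : Equiv.Perm (Fin m)) (x y : Fin n) :
    PEquiv.toFun (complIdem h T * groupElt h g) x = some y ↔
      ∃ i, Fin.castLE h i = x ∧ Fin.castLE h (g i) = y ∧ g i ∉ T := by
  rw [IS.mul_toFun]
  constructor
  · intro hxy
    by_cases hx : x.val < m
    · obtain ⟨i, rfl⟩ := exists_castLE h hx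
      rw [groupElt_toFun, Option.bind_some] at hxy
      by_cases hi : g i ∈ T
      · rw [complIdem_toFun_of_mem h hi] at hxy
        cases hxy
      · rw [complIdem_toFun_of_notMem h hi] at hxy
        exact ⟨i, rfl, Option.some.inj hxy, hi⟩
    · rw [groupElt_toFun_of_not_lt h _ hx] at hxy
      cases hxy
  · rintro ⟨i, rfl, rfl, hi⟩
    rw [groupElt_toFun, Option.bind_some, complIdem_toFun_of_notMem h hi]

/-- The partial bijection has its domain inside the first `m` points, so `p` takes values there. Its
domain condition reads `g (q i) ∉ T`; since `g (q i) = q (r i)` and `r` is a permutation, this is `q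
i ∉ T` for all `i`. -/
theorem card_embedding_complIdem_mul_groupElt {k : ℕ} (h : m ≤ n) (T : Finset (Fin m))
    (g : Equiv.Perm (Fin m)) (r : Equiv.Perm (Fin k)) :
    Nat.card {p : Fin k ↪ Fin n //
      ∀ i, PEquiv.toFun (complIdem h T * groupElt h g) (p i) = some (p (r i))} =
    Nat.card {q : Fin k ↪ Fin m // (∀ i, g (q i) = q (r i)) ∧ ∀ i, q i ∉ T} := by
  have hmap : ∀ q : {q : Fin k ↪ Fin m // (∀ i, g (q i) = q (r i)) ∧ ∀ i, q i ∉ T}, ∀ i,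
      PEquiv.toFun (complIdem h T * groupElt h g) (Fin.castLE h (q.1 i)) =
        some (Fin.castLE h (q.1 (r i))) := fun q i => by
    rw [complIdem_mul_groupElt_toFun_iff]
    refine ⟨q.1 i, rfl, ?_, ?_⟩
    · rw [q.2.1]
    · rw [q.2.1]
      exact q.2.2 _
  refine (Nat.card_eq_of_bijective
    (fun q => ⟨q.1.trans (Fin.castLEEmb h), fun i => hmap q i⟩) ⟨?_, ?_⟩).symm
  · rintro ⟨q, hq⟩ ⟨q', hq'⟩ hqq
    refine Subtype.ext (DFunLike.ext _ _ fun i => Fin.castLE_injective h ?_)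
    exact DFunLike.congr_fun (congrArg Subtype.val hqq) i
  · rintro ⟨p, hp⟩
    simp only [complIdem_mul_groupElt_toFun_iff] at hp
    choose q h1 h2 h3 using hp
    have hg : ∀ i, g (q i) = q (r i) := fun i => Fin.castLE_injective h (by rw [h2, h1])
    refine ⟨⟨⟨q, fun i j hij => p.injective (by rw [← h1, ← h1, hij])⟩, hg, fun i => ?_⟩, ?_⟩
    · have := h3 (r⁻¹ i)
      rw [hg, show r (r⁻¹ i) = i from Equiv.apply_symm_apply r i] at this
      exact this
    · exact Subtype.ext (DFunLike.ext _ _ h1)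

end Idempotents

/-! ### Irreducibility of the cell modules -/

section Irreducible

variable {n m : ℕ} {𝕜 : Type*} [Field 𝕜] (h : m ≤ n) (nu : m.Partition)

theorem N_cell_nv_base (p : Cell n m) (v : SpechtV 𝕜 nu) :
    N 𝕜 h nu p.1 (nv h nu (Cell.base h) v) = nv h nu p v := by
  have hp := p.mul_base h
  rw [N_nv_of_dom h nu p.1 (Cell.base h) v (by rw [hp, p.2])]
  congr 1
  exact congrArg (nv h nu) (Subtype.ext hp)

theorem N_groupElt_nv_base (g : Equiv.Perm (Fin m)) (v : SpechtV 𝕜 nu) :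
    N 𝕜 h nu (groupElt h g) (nv h nu (Cell.base h) v) =
      nv h nu (Cell.base h) (specht 𝕜 nu g v) := by
  rw [groupElt_eq_base_rmul, N_cell_nv_base, nv_rmul]

/-- A product `p⁻¹ q` takes values in the first `m` points, so it either leaves the cell or is a
permutation of these points, which is absorbed by the Specht factor. -/
theorem exists_N_inverse_eq (p : Cell n m) (w : NV 𝕜 h nu) :
    ∃ v, N 𝕜 h nu p.1.inverse w = nv h nu (Cell.base h) v := by
  induction w using nv_induction with
  | h0 => exact ⟨0, by rw [map_zero, map_zero]⟩
  | hadd x y hx hy =>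
    obtain ⟨v, hv⟩ := hx
    obtain ⟨v', hv'⟩ := hy
    exact ⟨v + v', by rw [map_add, map_add, hv, hv']⟩
  | hnv q v =>
    by_cases hd : (p.1.inverse * q.1).dom = {x : Fin n | x.val < m}
    · rw [N_nv_of_dom h nu _ q v hd]
      obtain ⟨g, hg⟩ := exists_base_rmul_eq h ⟨p.1.inverse * q.1, hd⟩ fun i => by
        have h1 := Cell.toFun_castLE h ⟨p.1.inverse * q.1, hd⟩ i
        rw [mul_toFun_castLE] at h1
        obtain ⟨j, hj, -⟩ := p.mem_range_of_inverse h h1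
        rw [← hj]
        exact j.2
      rw [hg, nv_rmul]
      exact ⟨_, rfl⟩
    · exact ⟨0, by rw [N_nv_of_not_dom h nu _ q v hd, map_zero]⟩

theorem exists_cell_range (X : {X : Finset (Fin n) // X.card = m}) :
    ∃ p : Cell n m, Set.range (p.val h) = X.1 := by
  refine ⟨(cellEquiv h).symm (X.1.orderEmbOfFin X.2).toEmbedding, ?_⟩
  have : ∀ i, ((cellEquiv h).symm (X.1.orderEmbOfFin X.2).toEmbedding).val h i =
      X.1.orderEmbOfFin X.2 i := fun i => by
    rw [← cellEquiv_apply, Equiv.apply_symm_apply]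
    rfl
  rw [funext this]
  exact Finset.range_orderEmbOfFin X.1 X.2

/-- The idempotent `p p⁻¹` is the identity on the range `X` of `p`. It fixes the class of `q ⊗ v` if
`q` has range `X`, and annihilates it otherwise, because both sets have `m` elements. -/
theorem sum_N_mul_inverse (p : {X : Finset (Fin n) // X.card = m} → Cell n m)
    (hp : ∀ X, Set.range ((p X).val h) = X.1) (w : NV 𝕜 h nu) :
    ∑ X, N 𝕜 h nu ((p X).1 * (p X).1.inverse) w = w := by
  induction w using nv_induction with
  | h0 => simp only [map_zero, Finset.sum_const_zero]
  | hadd x y hx hy => simp only [map_add, Finset.sum_add_distrib, hx, hy]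
  | hnv q v =>
    let X₀ : {X : Finset (Fin n) // X.card = m} :=
      ⟨Finset.univ.map (cellEquiv h q), by simp⟩
    have hX₀ : (X₀.1 : Set (Fin n)) = Set.range (q.val h) := by
      ext x
      simp [X₀, cellEquiv_apply]
    rw [Finset.sum_eq_single X₀]
    · have hmem : ∀ i, ∃ j, (p X₀).val h j = q.val h i := fun i => by
        have : q.val h i ∈ Set.range ((p X₀).val h) := by
          rw [hp, hX₀]
          exact ⟨i, rfl⟩
        exact this
      have hfix : (p X₀).1 * (p X₀).1.inverse * q.1 = q.1 := by
        rw [IS.eq_cell_iff h]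
        refine ⟨fun x hx => mul_toFun_of_not_lt q _ hx, fun i => ?_⟩
        obtain ⟨j, hj⟩ := hmem i
        rw [mul_toFun_castLE, ← hj, Cell.mul_inverse_toFun]
      rw [N_nv_of_dom h nu _ q v (by rw [hfix, q.2])]
      congr 1
      exact congrArg (nv h nu) (Subtype.ext hfix)
    · intro X _ hX
      refine N_nv_of_not_dom h nu _ q v fun hd => hX ?_
      rw [mul_dom_eq_iff h] at hd
      refine Subtype.ext (Finset.eq_of_subset_of_card_le (fun x hx => ?_) ?_).symm
      · rw [← Finset.mem_coe, hX₀] at hx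
        obtain ⟨i, rfl⟩ := hx
        have := (Cell.mem_dom_mul_inverse h _ _).1 (hd i)
        rwa [hp] at this
      · rw [X.2, X₀.2]
    · exact fun hX => absurd (Finset.mem_univ _) hX

theorem exists_N_inverse_ne_zero {w : NV 𝕜 h nu} (hw : w ≠ 0) :
    ∃ p : Cell n m, N 𝕜 h nu p.1.inverse w ≠ 0 := by
  by_contra! H
  choose p hp using exists_cell_range (m := m) h
  refine hw ?_
  rw [← sum_N_mul_inverse h nu p hp w]
  refine Finset.sum_eq_zero fun X _ => ?_
  rw [map_mul, Module.End.mul_apply, H, map_zero]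

/-- Some inverse of a cell element moves a nonzero vector of `U` to a nonzero vector over the base
point. The Specht vectors lying in `U` over that point form a nonzero subrepresentation, hence all
of `S^nu`, and the cell elements carry them onto generators of `N^nu`. -/
theorem N_isIrreducible [CharZero 𝕜] [Nontrivial (NV 𝕜 h nu)] : (N 𝕜 h nu).IsIrreducible := by
  obtain ⟨w₀, hw₀⟩ := exists_ne (0 : NV 𝕜 h nu)
  refine { exists_pair_ne := ⟨⊥, ⊤, fun hbt => hw₀ ?_⟩, eq_bot_or_eq_top := fun U => ?_ }
  · have : w₀ ∈ (⊤ : Subrepresentation (N 𝕜 h nu)).toSubmodule := trivial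
    rw [← hbt] at this
    exact this
  · by_cases hU : U.toSubmodule = ⊥
    · exact Or.inl (Subrepresentation.toSubmodule_injective hU)
    right
    obtain ⟨w, hwU, hw⟩ := Submodule.exists_mem_ne_zero_of_ne_bot hU
    obtain ⟨p, hp⟩ := exists_N_inverse_ne_zero h nu hw
    obtain ⟨v, hv⟩ := exists_N_inverse_eq h nu p w
    let U' : Subrepresentation (specht 𝕜 nu) :=
      { toSubmodule := U.toSubmodule.comap (nv h nu (Cell.base h))
        apply_mem_toSubmodule := fun g v hv => by
          rw [Submodule.mem_comap, ← N_groupElt_nv_base]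
          exact U.apply_mem_toSubmodule _ hv }
    have hvU : v ∈ U'.toSubmodule := by
      rw [Submodule.mem_comap, ← hv]
      exact U.apply_mem_toSubmodule _ hwU
    have hv0 : v ≠ 0 := by
      rintro rfl
      exact hp (by rw [hv, map_zero])
    have hU' : U' = ⊤ := by
      refine (eq_bot_or_eq_top U').resolve_left fun hbot => hv0 ?_
      rw [hbot] at hvU
      exact hvU
    refine Subrepresentation.toSubmodule_injective (eq_top_iff.2 fun x _ => ?_)
    induction x using nv_induction with
    | h0 => exact U.toSubmodule.zero_mem
    | hadd x y hx hy => exact U.toSubmodule.add_mem (hx trivial) (hy trivial)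
    | hnv q u =>
      rw [← N_cell_nv_base]
      have : u ∈ U'.toSubmodule := by
        rw [hU']
        trivial
      exact U.apply_mem_toSubmodule _ this

end Irreducible

end

section

/-! ### An element that detects a cell module -/

/-- Under `Hom(V, W) ≅ V* ⊗ W` this operator becomes the tensor product of the transpose of `B` with
`A`. -/
theorem trace_comp_comp {𝕜 V W : Type*} [Field 𝕜] [AddCommGroup V] [Module 𝕜 V]
    [FiniteDimensional 𝕜 V] [AddCommGroup W] [Module 𝕜 W] [FiniteDimensional 𝕜 W]
    (A : W →ₗ[𝕜] W) (B : V →ₗ[𝕜] V) :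
    LinearMap.trace 𝕜 (V →ₗ[𝕜] W) (LinearMap.llcomp 𝕜 V W W A ∘ₗ LinearMap.lcomp 𝕜 W B) =
      LinearMap.trace 𝕜 W A * LinearMap.trace 𝕜 V B := by
  have h1 : LinearMap.llcomp 𝕜 V W W A ∘ₗ LinearMap.lcomp 𝕜 W B =
      (dualTensorHomEquiv 𝕜 V W).conj (TensorProduct.map (Module.Dual.transpose B) A) := by
    refine LinearMap.ext fun θ => ?_
    obtain ⟨t, rfl⟩ := (dualTensorHomEquiv 𝕜 V W).surjective θ
    rw [LinearEquiv.conj_apply_apply, LinearEquiv.symm_apply_apply]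
    induction t using TensorProduct.induction_on with
    | zero => simp only [map_zero]
    | add x y hx hy => simp only [map_add, hx, hy]
    | tmul f w =>
      ext v
      simp [Module.Dual.transpose_apply]
  rw [h1]
  refine (LinearMap.trace_conj' (M := Module.Dual 𝕜 V ⊗[𝕜] W) _ _).trans ?_
  rw [LinearMap.trace_tensorProduct', LinearMap.trace_transpose', mul_comm]

/-- An alternating sum over all sets kills the elements that meet no constraint. -/
theorem sum_neg_one_pow_mul_card_disjoint {𝕜 ι P : Type*} [Field 𝕜] [Fintype ι] [DecidableEq ι]
    [Finite P] (p : P → Prop) (C : P → ι → Prop) :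
    ∑ T : Finset ι, (-1 : 𝕜) ^ T.card * (Nat.card {x // p x ∧ ∀ i, C x i → i ∉ T} : 𝕜) =
      (Nat.card {x // p x ∧ ∀ i, C x i} : 𝕜) := by
  classical
  let _ := Fintype.ofFinite P
  have h1 : ∀ T : Finset ι, (Nat.card {x // p x ∧ ∀ i, C x i → i ∉ T} : 𝕜) =
      ∑ x : P with p x, if ∀ i, C x i → i ∉ T then 1 else 0 := fun T => by
    rw [Finset.sum_boole, Finset.filter_filter, Nat.card_eq_fintype_card, Fintype.card_subtype]
  have h2 : (Nat.card {x // p x ∧ ∀ i, C x i} : 𝕜) =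
      ∑ x : P with p x, if ∀ i, C x i then 1 else 0 := by
    rw [Finset.sum_boole, Finset.filter_filter, Nat.card_eq_fintype_card, Fintype.card_subtype]
  simp only [h1, Finset.mul_sum]
  rw [Finset.sum_comm, h2]
  refine Finset.sum_congr rfl fun x _ => ?_
  -- For fixed `x` the sets that contribute are the subsets of `{i | ¬ C x i}`, whose alternating
  -- count is zero unless that set is empty.
  have h3 : ∀ T : Finset ι, (∀ i, C x i → i ∉ T) ↔ T ∈ (Finset.univ.filter (¬ C x ·)).powerset :=
    fun T => by
    simp only [Finset.mem_powerset, Finset.subset_iff, Finset.mem_filter, Finset.mem_univ, true_and]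
    exact ⟨fun H i hi hc => H i hc hi, fun H i hc hi => H hi hc⟩
  simp only [h3, mul_ite, mul_one, mul_zero]
  rw [← Finset.sum_filter, Finset.filter_mem_eq_inter, Finset.univ_inter]
  have h4 := congrArg (Int.cast : ℤ → 𝕜)
    (Finset.sum_powerset_neg_one_pow_card (x := Finset.univ.filter (¬ C x ·)))
  push_cast at h4
  rw [h4]
  simp [Finset.filter_eq_empty_iff]

section Test

variable {n m : ℕ} {𝕜 : Type*} [Field 𝕜] (h : m ≤ n)

/-- An element of the monoid algebra that has trace one on `N^nu` and trace zero on every other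
simple module. -/
def cellTest (nu : m.Partition) : MonoidAlgebra 𝕜 (IS n) :=
  ∑ z : Equiv.Perm (Fin m) × Finset (Fin m),
    MonoidAlgebra.single (complIdem h z.2 * groupElt h z.1)
      ((Nat.card (Equiv.Perm (Fin m)) : 𝕜)⁻¹ * (chi 𝕜 nu z.1 * (-1) ^ z.2.card))

variable (nu : m.Partition)

theorem trace_cellTest {V : Type*} [AddCommGroup V] [Module 𝕜 V] (ρ : Representation 𝕜 (IS n) V) :
    LinearMap.trace 𝕜 V (ρ.asAlgebraHom (cellTest h nu)) =
      avg fun g => chi 𝕜 nu g *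
        ∑ T : Finset (Fin m), (-1) ^ T.card * ρ.character (complIdem h T * groupElt h g) := by
  rw [cellTest, trace_sum_single, Fintype.sum_prod_type, avg, Finset.mul_sum]
  refine Finset.sum_congr rfl fun g _ => ?_
  rw [Finset.mul_sum, Finset.mul_sum]
  exact Finset.sum_congr rfl fun T _ => by ring

/-- The alternating average of `τ(e g) θ ν(g⁻¹)` for a representation `τ` of the symmetric inverse
semigroup. -/
def cellAverage {S : Type*} [AddCommGroup S] [Module 𝕜 S] (τ : Representation 𝕜 (IS n) S) :
    (SpechtV 𝕜 nu →ₗ[𝕜] S) →ₗ[𝕜] (SpechtV 𝕜 nu →ₗ[𝕜] S) :=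
  ∑ g : Equiv.Perm (Fin m), ∑ T : Finset (Fin m), (-1 : 𝕜) ^ T.card •
    (LinearMap.llcomp 𝕜 (SpechtV 𝕜 nu) S S (τ (complIdem h T * groupElt h g)) ∘ₗ
      LinearMap.lcomp 𝕜 S (specht 𝕜 nu g⁻¹))

theorem cellAverage_apply {S : Type*} [AddCommGroup S] [Module 𝕜 S] (τ : Representation 𝕜 (IS n) S)
    (θ : SpechtV 𝕜 nu →ₗ[𝕜] S) (v : SpechtV 𝕜 nu) :
    cellAverage h nu τ θ v = ∑ g : Equiv.Perm (Fin m), ∑ T : Finset (Fin m), (-1 : 𝕜) ^ T.card •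
      τ (complIdem h T * groupElt h g) (θ (specht 𝕜 nu g⁻¹ v)) := by
  simp [cellAverage, LinearMap.sum_apply]

/-- Substitute `r g` for `g` and `r T` for `T`, using that conjugation by `r` carries the idempotent
of `T` to that of `r T`. -/
theorem groupElt_cellAverage {S : Type*} [AddCommGroup S] [Module 𝕜 S]
    (τ : Representation 𝕜 (IS n) S) (θ : SpechtV 𝕜 nu →ₗ[𝕜] S) (r : Equiv.Perm (Fin m))
    (v : SpechtV 𝕜 nu) : τ (groupElt h r) (cellAverage h nu τ θ v) =
      cellAverage h nu τ θ (specht 𝕜 nu r v) := by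
  rw [cellAverage_apply, cellAverage_apply, map_sum]
  refine Fintype.sum_equiv (Equiv.mulLeft r) _ _ fun g => ?_
  rw [map_sum]
  refine Fintype.sum_equiv (Equiv.finsetCongr r) _ _ fun T => ?_
  rw [map_smul, ← Module.End.mul_apply (τ _) (τ _), ← map_mul, ← mul_assoc,
    groupElt_mul_complIdem, mul_assoc, ← groupElt_mul, Equiv.coe_mulLeft, Equiv.finsetCongr_apply,
    Finset.card_map, ← Module.End.mul_apply (specht 𝕜 nu _) (specht 𝕜 nu _), ← map_mul,
    mul_inv_rev, inv_mul_cancel_right]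

/-- Multiplying by the idempotent of `{j}` replaces `T` by `T ∪ {j}`, so the terms of `T` and of its
symmetric difference with `{j}` cancel. -/
theorem complIdem_cellAverage {S : Type*} [AddCommGroup S] [Module 𝕜 S]
    (τ : Representation 𝕜 (IS n) S) (θ : SpechtV 𝕜 nu →ₗ[𝕜] S) (j : Fin m)
    (v : SpechtV 𝕜 nu) : τ (complIdem h {j}) (cellAverage h nu τ θ v) = 0 := by
  rw [cellAverage_apply, map_sum]
  refine Finset.sum_eq_zero fun g _ => ?_
  rw [map_sum]
  have key : ∀ T : Finset (Fin m), τ (complIdem h {j}) ((-1 : 𝕜) ^ T.card •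
      τ (complIdem h T * groupElt h g) (θ (specht 𝕜 nu g⁻¹ v))) = (-1 : 𝕜) ^ T.card •
      τ (complIdem h (insert j T) * groupElt h g) (θ (specht 𝕜 nu g⁻¹ v)) := fun T => by
    rw [map_smul, ← Module.End.mul_apply (τ _) (τ _), ← map_mul, ← mul_assoc, complIdem_mul,
      Finset.insert_eq]
  simp only [key]
  refine Finset.sum_ninvolution (fun T => if j ∈ T then T.erase j else insert j T)
    (fun T => ?_) (fun T _ => ?_) (fun T => Finset.mem_univ _) fun T => ?_
  · by_cases hj : j ∈ T
    · rw [if_pos hj, Finset.insert_erase hj, Finset.insert_eq_of_mem hj, ← add_smul,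
        ← Finset.card_erase_add_one hj, pow_succ]
      simp
    · rw [if_neg hj, Finset.insert_idem, ← add_smul, Finset.card_insert_of_notMem hj, pow_succ]
      simp
  · by_cases hj : j ∈ T
    · rw [if_pos hj]
      exact fun he => Finset.erase_ne_self.2 hj he
    · rw [if_neg hj]
      exact fun he => hj (he ▸ Finset.mem_insert_self j T)
  · by_cases hj : j ∈ T
    · rw [if_pos hj, if_neg (Finset.notMem_erase j T), Finset.insert_erase hj]
    · rw [if_neg hj, if_pos (Finset.mem_insert_self j T), Finset.erase_insert hj]

theorem trace_cellAverage [CharZero 𝕜] {S : Type*} [AddCommGroup S] [Module 𝕜 S]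
    [FiniteDimensional 𝕜 S] (τ : Representation 𝕜 (IS n) S) :
    (Nat.card (Equiv.Perm (Fin m)) : 𝕜)⁻¹ * LinearMap.trace 𝕜 _ (cellAverage h nu τ) =
      LinearMap.trace 𝕜 S (τ.asAlgebraHom (cellTest h nu)) := by
  rw [trace_cellTest, avg, cellAverage, map_sum]
  congr 1
  refine Finset.sum_congr rfl fun g _ => ?_
  rw [map_sum, Finset.mul_sum]
  refine Finset.sum_congr rfl fun T _ => ?_
  rw [map_smul, trace_comp_comp, ← (isClassFun_chi nu).apply_inv g, smul_eq_mul, chi,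
    Representation.character, Representation.character]
  ring

/-- The map sends `p ⊗ v` to `τ(p) η(v)`. Equivariance of `η` under `S_m` makes it well defined, and
the vanishing of the idempotents of `{j}` on the image of `η` gives compatibility when a product
leaves the cell. -/
theorem exists_intertwiningMap_of_cellAverage {S : Type*} [AddCommGroup S] [Module 𝕜 S]
    (τ : Representation 𝕜 (IS n) S) (θ : SpechtV 𝕜 nu →ₗ[𝕜] S) (hθ : cellAverage h nu τ θ ≠ 0) :
    ∃ F : (N 𝕜 h nu).IntertwiningMap τ, F ≠ 0 := by
  set η := cellAverage h nu τ θ with hη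
  obtain ⟨F, hF⟩ := exists_nv_lift h nu (fun p => τ p.1 ∘ₗ η) fun p g v => by
    rw [LinearMap.comp_apply, LinearMap.comp_apply, hη, ← groupElt_cellAverage,
      ← Module.End.mul_apply (τ _) (τ _), ← map_mul]
    rfl
  have hint : ∀ σ w, F (N 𝕜 h nu σ w) = τ σ (F w) := fun σ w => by
    induction w using nv_induction with
    | h0 => simp only [map_zero]
    | hadd x y hx hy => simp only [map_add, hx, hy]
    | hnv p v =>
      rw [hF, LinearMap.comp_apply, ← Module.End.mul_apply (τ _) (τ _), ← map_mul]
      by_cases hd : (σ * p.1).dom = {x : Fin n | x.val < m}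
      · rw [N_nv_of_dom h nu σ p v hd, hF, LinearMap.comp_apply]
      · obtain ⟨j, hj⟩ := exists_mul_complIdem_eq h p σ hd
        rw [N_nv_of_not_dom h nu σ p v hd, map_zero, ← hj, map_mul, Module.End.mul_apply, hη,
          complIdem_cellAverage, map_zero]
  refine ⟨⟨F, fun σ => LinearMap.ext (hint σ)⟩, fun h0 => hθ (LinearMap.ext fun v => ?_)⟩
  have h1 : F (nv h nu (Cell.base h) (specht 𝕜 nu 1 v)) = 0 :=
    LinearMap.congr_fun (congrArg Representation.IntertwiningMap.toLinearMap h0) _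
  rw [hF, LinearMap.comp_apply, base_eq_groupElt_one, hη, groupElt_cellAverage, map_one] at h1
  exact h1

/-- Up to the factor `m!`, this is the trace of `cellAverage`. If it were nonzero, some average
would give a nonzero map from `N^nu`, an isomorphism by Schur's lemma. -/
theorem trace_cellTest_eq_zero [CharZero 𝕜] [Nontrivial (NV 𝕜 h nu)] {S : Type*} [AddCommGroup S]
    [Module 𝕜 S] [FiniteDimensional 𝕜 S] (τ : Representation 𝕜 (IS n) S) (hτ : τ.IsIrreducible)
    (he : IsEmpty (τ.Equiv (N 𝕜 h nu))) :
    LinearMap.trace 𝕜 S (τ.asAlgebraHom (cellTest h nu)) = 0 := by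
  by_contra hne
  have hP : cellAverage h nu τ ≠ 0 := fun h0 => hne (by
    rw [← trace_cellAverage, h0, map_zero, mul_zero])
  obtain ⟨θ, hθ⟩ : ∃ θ, cellAverage h nu τ θ ≠ 0 := by
    by_contra! H
    exact hP (LinearMap.ext H)
  obtain ⟨F, hF⟩ := exists_intertwiningMap_of_cellAverage h nu τ θ hθ
  have := N_isIrreducible (𝕜 := 𝕜) h nu
  exact he.false (F.ofBijective
    ((Representation.IsIrreducible.bijective_or_eq_zero F).resolve_right hF)).symm

end Test

end

/-! ### Transitive actions and their point stabilizers -/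

section

/-- A class function averaged against the permutation character of a transitive action is averaged
over the stabilizer of a point. -/
theorem avg_mul_card_fixedBy {𝕜 Γ H Z : Type*} [Field 𝕜] [CharZero 𝕜] [Group Γ] [Fintype Γ]
    [Group H] [Fintype H] [MulAction Γ Z] [Finite Z] [MulAction.IsPretransitive Γ Z] (z₀ : Z)
    (ψ : H →* Γ) (hψ : Function.Injective ψ) (hstab : ∀ γ : Γ, γ • z₀ = z₀ ↔ γ ∈ Set.range ψ)
    {f : Γ → 𝕜} (hf : IsClassFun f) :
    (avg fun γ => f γ * (Nat.card {z : Z // γ • z = z} : 𝕜)) = avg fun x => f (ψ x) := by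
  classical
  let _ := Fintype.ofFinite Z
  have h1 : ∀ γ : Γ, f γ * (Nat.card {z : Z // γ • z = z} : 𝕜) =
      ∑ z : Z, if γ • z = z then f γ else 0 := fun γ => by
    rw [Nat.card_eq_fintype_card, Fintype.card_subtype, Finset.cast_card, Finset.mul_sum,
      Finset.sum_filter]
    simp only [mul_one]
  -- By transitivity all point stabilizers are conjugate, so a class function has the same sum over
  -- each of them.
  have h2 : ∀ z : Z, (∑ γ : Γ, if γ • z = z then f γ else 0) = ∑ x, f (ψ x) := fun z => by
    obtain ⟨δ, rfl⟩ := MulAction.exists_smul_eq Γ z₀ z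
    have h3 : (∑ γ : Γ, if γ • z₀ = z₀ then f γ else 0) =
        ∑ γ : Γ, if γ • δ • z₀ = δ • z₀ then f γ else 0 := by
      refine Fintype.sum_equiv (MulAut.conj δ).toEquiv _ _ fun γ => ?_
      have h4 : (MulAut.conj δ).toEquiv γ = δ * γ * δ⁻¹ := rfl
      have h5 : (δ * γ * δ⁻¹) • δ • z₀ = δ • γ • z₀ := by
        rw [← mul_smul, ← mul_smul, inv_mul_cancel_right]
      rw [h4, h5, hf, smul_left_cancel_iff]
    rw [← h3, ← Finset.sum_filter, ← Finset.sum_image (s := Finset.univ) (g := ψ)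
      (f := f) fun x _ y _ hxy => hψ hxy]
    refine Finset.sum_congr ?_ fun _ _ => rfl
    ext γ
    simp [hstab]
  have h3 : Nat.card Z * Nat.card H = Nat.card Γ := by
    rw [← MulAction.index_stabilizer_of_transitive Γ z₀,
      ← (MulAction.stabilizer Γ z₀).index_mul_card]
    congr 1
    have h4 : MulAction.stabilizer Γ z₀ = ψ.range := by
      ext γ
      rw [MulAction.mem_stabilizer_iff, hstab]
      rfl
    rw [h4]
    exact Nat.card_congr (MonoidHom.ofInjective hψ).toEquiv
  have hZ : (Nat.card Z : 𝕜) ≠ 0 :=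
    have : Nonempty Z := ⟨z₀⟩
    Nat.cast_ne_zero.2 Nat.card_pos.ne'
  simp only [avg, h1]
  rw [Finset.sum_comm, Finset.sum_congr rfl fun z _ => h2 z, Finset.sum_const, Finset.card_univ,
    ← Nat.card_eq_fintype_card, ← h3, Nat.cast_mul, nsmul_eq_mul, mul_inv,
    mul_comm _ (Nat.card H : 𝕜)⁻¹, mul_assoc, inv_mul_cancel_left₀ hZ]

theorem exists_perm_of_card_fiber_eq {α κ : Type*} [Finite α] (f f' : α → κ)
    (hcard : ∀ c, Nat.card {x // f x = c} = Nat.card {x // f' x = c}) :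
    ∃ σ : Equiv.Perm α, ∀ x, f' (σ x) = f x := by
  have e : ∀ c, {x // f x = c} ≃ {x // f' x = c} := fun c => (Finite.card_eq.1 (hcard c)).some
  refine ⟨(Equiv.sigmaFiberEquiv f).symm.trans
    ((Equiv.sigmaCongrRight e).trans (Equiv.sigmaFiberEquiv f')), fun x => ?_⟩
  exact (e (f x) ⟨x, rfl⟩).2

/-! ### Pairs of embeddings that cover their target -/

/-- Pairs of embeddings whose images cover the target. -/
def CoveringPair (k l m : ℕ) : Type :=
  {z : (Fin k ↪ Fin m) × (Fin l ↪ Fin m) // ∀ x, x ∈ Set.range z.1 ∨ x ∈ Set.range z.2}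

namespace CoveringPair

variable {k l m : ℕ}

instance : Finite (CoveringPair k l m) := Subtype.finite

theorem ext {z z' : CoveringPair k l m} (h1 : ∀ i, z.1.1 i = z'.1.1 i)
    (h2 : ∀ j, z.1.2 j = z'.1.2 j) : z = z' :=
  Subtype.ext (Prod.ext (DFunLike.ext _ _ h1) (DFunLike.ext _ _ h2))

instance : MulAction (Equiv.Perm (Fin m) × Equiv.Perm (Fin k) × Equiv.Perm (Fin l))
    (CoveringPair k l m) where
  smul γ z := ⟨(γ.2.1⁻¹.toEmbedding.trans (z.1.1.trans γ.1.toEmbedding),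
    γ.2.2⁻¹.toEmbedding.trans (z.1.2.trans γ.1.toEmbedding)), fun x => by
      rcases z.2 (γ.1⁻¹ x) with ⟨i, hi⟩ | ⟨j, hj⟩
      · exact Or.inl ⟨γ.2.1 i, by simp [hi]⟩
      · exact Or.inr ⟨γ.2.2 j, by simp [hj]⟩⟩
  one_smul z := rfl
  mul_smul γ δ z := rfl

theorem smul_fst (γ : Equiv.Perm (Fin m) × Equiv.Perm (Fin k) × Equiv.Perm (Fin l))
    (z : CoveringPair k l m) (i : Fin k) : (γ • z).1.1 i = γ.1 (z.1.1 (γ.2.1⁻¹ i)) := rfl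

theorem smul_snd (γ : Equiv.Perm (Fin m) × Equiv.Perm (Fin k) × Equiv.Perm (Fin l))
    (z : CoveringPair k l m) (j : Fin l) : (γ • z).1.2 j = γ.1 (z.1.2 (γ.2.2⁻¹ j)) := rfl

theorem smul_eq_iff (γ : Equiv.Perm (Fin m) × Equiv.Perm (Fin k) × Equiv.Perm (Fin l))
    (z z' : CoveringPair k l m) : γ • z = z' ↔
      (∀ i, γ.1 (z.1.1 i) = z'.1.1 (γ.2.1 i)) ∧ ∀ j, γ.1 (z.1.2 j) = z'.1.2 (γ.2.2 j) := by
  constructor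
  · rintro rfl
    refine ⟨fun i => ?_, fun j => ?_⟩
    · rw [smul_fst]
      exact congrArg (fun i => γ.1 (z.1.1 i)) (Equiv.symm_apply_apply γ.2.1 i).symm
    · rw [smul_snd]
      exact congrArg (fun j => γ.1 (z.1.2 j)) (Equiv.symm_apply_apply γ.2.2 j).symm
  · rintro ⟨h1, h2⟩
    refine ext (fun i => ?_) fun j => ?_
    · rw [smul_fst, h1]
      exact congrArg z'.1.1 (Equiv.apply_symm_apply γ.2.1 i)
    · rw [smul_snd, h2]
      exact congrArg z'.1.2 (Equiv.apply_symm_apply γ.2.2 j)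

/-- Membership of an element in the two images. -/
def mem (z : CoveringPair k l m) (x : Fin m) : Bool × Bool :=
  (decide (x ∈ Finset.univ.map z.1.1), decide (x ∈ Finset.univ.map z.1.2))

theorem mem_fst (z : CoveringPair k l m) (x : Fin m) :
    (z.mem x).1 = true ↔ x ∈ Set.range z.1.1 := by
  simp [mem]

theorem mem_snd (z : CoveringPair k l m) (x : Fin m) :
    (z.mem x).2 = true ↔ x ∈ Set.range z.1.2 := by
  simp [mem]

/-- Covering forces the size of the overlap, and with it the sizes of both differences. These
numbers do not depend on the pair, which makes the action transitive. None of the subtractions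
truncates, as the existence of `z` implies the needed inequalities. -/
theorem card_fiber (z : CoveringPair k l m) (c : Bool × Bool) :
    Nat.card {x // z.mem x = c} =
      bif c.1 then (bif c.2 then k + l - m else m - l) else bif c.2 then m - k else 0 := by
  rw [Nat.card_eq_fintype_card, Fintype.card_subtype]
  set R := Finset.univ.map z.1.1 with hR
  set R' := Finset.univ.map z.1.2 with hR'
  have hk : R.card = k := by simp [hR]
  have hl : R'.card = l := by simp [hR']
  have hmem : ∀ x, x ∈ R ∨ x ∈ R' := fun x => by
    rcases z.2 x with ⟨i, hi⟩ | ⟨j, hj⟩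
    · exact Or.inl (by simp [hR, ← hi])
    · exact Or.inr (by simp [hR', ← hj])
  have hu : R ∪ R' = Finset.univ :=
    Finset.eq_univ_of_forall fun x => Finset.mem_union.2 (hmem x)
  have h1 := Finset.card_union_add_card_inter R R'
  rw [hu, Finset.card_univ, Fintype.card_fin, hk, hl] at h1
  have h2 := Finset.card_sdiff_add_card_inter R R'
  have h3 := Finset.card_sdiff_add_card_inter R' R
  rw [Finset.inter_comm] at h3
  have hf : ∀ x, z.mem x = (decide (x ∈ R), decide (x ∈ R')) := fun x => rfl
  rcases c with ⟨_ | _, _ | _⟩ <;> simp only [hf, cond_true, cond_false, Prod.mk.injEq,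
    decide_eq_true_eq, decide_eq_false_iff_not]
  · rw [Finset.card_eq_zero, Finset.filter_eq_empty_iff]
    exact fun x _ hx => (hmem x).elim hx.1 hx.2
  · have : Finset.univ.filter (fun x => x ∉ R ∧ x ∈ R') = R' \ R := by
      ext x
      simp [and_comm]
    rw [this]
    omega
  · have : Finset.univ.filter (fun x => x ∈ R ∧ x ∉ R') = R \ R' := by
      ext x
      simp
    rw [this]
    omega
  · have : Finset.univ.filter (fun x => x ∈ R ∧ x ∈ R') = R ∩ R' := by
      ext x
      simp
    rw [this]
    omega

theorem exists_perm_range (z z' : CoveringPair k l m) : ∃ g : Equiv.Perm (Fin m), ∀ x,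
    (x ∈ Set.range z.1.1 ↔ g x ∈ Set.range z'.1.1) ∧
      (x ∈ Set.range z.1.2 ↔ g x ∈ Set.range z'.1.2) := by
  obtain ⟨g, hg⟩ := exists_perm_of_card_fiber_eq z.mem z'.mem fun c => by
    rw [card_fiber, card_fiber]
  exact ⟨g, fun x => ⟨by rw [← mem_fst, ← mem_fst, hg], by rw [← mem_snd, ← mem_snd, hg]⟩⟩

theorem exists_perm_comp_eq {p : ℕ} (q q' : Fin p ↪ Fin m) (g : Equiv.Perm (Fin m))
    (hg : ∀ x, x ∈ Set.range q ↔ g x ∈ Set.range q') :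
    ∃ r : Equiv.Perm (Fin p), ∀ i, g (q i) = q' (r i) := by
  choose f hf using fun i => (hg (q i)).1 ⟨i, rfl⟩
  have hinj : Function.Injective f := fun i j hij => q.injective (g.injective (by
    rw [← hf, ← hf, hij]))
  exact ⟨Equiv.ofBijective f (Finite.injective_iff_bijective.1 hinj), fun i => (hf i).symm⟩

instance : MulAction.IsPretransitive
    (Equiv.Perm (Fin m) × Equiv.Perm (Fin k) × Equiv.Perm (Fin l)) (CoveringPair k l m) where
  exists_smul_eq z z' := by
    obtain ⟨g, hg⟩ := exists_perm_range z z'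
    obtain ⟨r, hr⟩ := exists_perm_comp_eq z.1.1 z'.1.1 g fun x => (hg x).1
    obtain ⟨s, hs⟩ := exists_perm_comp_eq z.1.2 z'.1.2 g fun x => (hg x).2
    exact ⟨(g, r, s), (smul_eq_iff _ _ _).2 ⟨hr, hs⟩⟩

theorem max_le (z : CoveringPair k l m) : max k l ≤ m := by
  have h1 := Fintype.card_le_of_embedding z.1.1
  have h2 := Fintype.card_le_of_embedding z.1.2
  simp only [Fintype.card_fin] at h1 h2
  omega

theorem le_add (z : CoveringPair k l m) : m ≤ k + l := by
  have h : Function.Surjective (Sum.elim z.1.1 z.1.2) := fun x => by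
    rcases z.2 x with ⟨i, hi⟩ | ⟨j, hj⟩
    · exact ⟨Sum.inl i, hi⟩
    · exact ⟨Sum.inr j, hj⟩
  have := Fintype.card_le_of_surjective _ h
  simpa using this

end CoveringPair

/-! ### The stabilizer of the standard pair -/

section Standard

variable (a b c : ℕ)

theorem youngEmb_castAdd {p q : ℕ} (u : Equiv.Perm (Fin p)) (v : Equiv.Perm (Fin q)) (i : Fin p) :
    youngEmb rfl (u, v) (Fin.castAdd q i) = Fin.castAdd q (u i) := by
  simp [youngEmb, Equiv.permCongrHom, Equiv.permCongr_apply, ← finSumFinEquiv_apply_left]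

theorem youngEmb_natAdd {p q : ℕ} (u : Equiv.Perm (Fin p)) (v : Equiv.Perm (Fin q)) (i : Fin q) :
    youngEmb rfl (u, v) (Fin.natAdd p i) = Fin.natAdd p (v i) := by
  simp [youngEmb, Equiv.permCongrHom, Equiv.permCongr_apply, ← finSumFinEquiv_apply_right]

theorem castAdd_ne_natAdd {p q : ℕ} (i : Fin p) (j : Fin q) : Fin.castAdd q i ≠ Fin.natAdd p j := by
  intro h
  have := congrArg Fin.val h
  simp only [Fin.val_castAdd, Fin.val_natAdd] at this
  omega

theorem youngEmb_injective {p q : ℕ} : Function.Injective (youngEmb (rfl : p + q = p + q)) := by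
  rintro ⟨u, v⟩ ⟨u', v'⟩ h
  refine Prod.ext (Equiv.ext fun i => ?_) (Equiv.ext fun j => ?_)
  · have := Equiv.congr_fun h (Fin.castAdd q i)
    rw [youngEmb_castAdd, youngEmb_castAdd] at this
    exact Fin.castAdd_injective p q this
  · have := Equiv.congr_fun h (Fin.natAdd p j)
    rw [youngEmb_natAdd, youngEmb_natAdd] at this
    exact Fin.natAdd_injective q p this

theorem exists_youngEmb_eq {p q : ℕ} (g : Equiv.Perm (Fin (p + q)))
    (hg : ∀ i, ∃ j, g (Fin.castAdd q i) = Fin.castAdd q j) : ∃ u v, g = youngEmb rfl (u, v) := by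
  have h1 : finSumFinEquiv.permCongr.symm g ∈ (Equiv.Perm.sumCongrHom (Fin p) (Fin q)).range := by
    refine Equiv.Perm.mem_sumCongrHom_range_of_perm_mapsTo_inl ?_
    rintro _ ⟨i, rfl⟩
    obtain ⟨j, hj⟩ := hg i
    refine ⟨j, ?_⟩
    change Sum.inl j = finSumFinEquiv.symm (g (Fin.castAdd q i))
    rw [hj, finSumFinEquiv_symm_apply_castAdd]
  obtain ⟨⟨u, v⟩, huv⟩ := h1
  refine ⟨u, v, ?_⟩
  rw [Equiv.eq_symm_apply] at huv
  rw [← huv]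
  rfl

/-- The last `c` elements, followed by the middle `b` elements. -/
def standardFun : Fin (c + b) → Fin (a + b + c) :=
  Fin.addCases (fun i => Fin.natAdd (a + b) i) fun j => Fin.castAdd c (Fin.natAdd a j)

theorem standardFun_castAdd (i : Fin c) :
    standardFun a b c (Fin.castAdd b i) = Fin.natAdd (a + b) i := by
  rw [standardFun, Fin.addCases_left]

theorem standardFun_natAdd (j : Fin b) :
    standardFun a b c (Fin.natAdd c j) = Fin.castAdd c (Fin.natAdd a j) := by
  rw [standardFun, Fin.addCases_right]

theorem standardFun_injective : Function.Injective (standardFun a b c) := by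
  intro i j
  refine Fin.addCases (fun i => ?_) (fun i => ?_) i <;>
    refine Fin.addCases (fun j => ?_) (fun j => ?_) j <;>
    simp only [standardFun_castAdd, standardFun_natAdd] <;> intro h
  · rw [Fin.natAdd_injective _ _ h]
  · exact absurd h.symm (castAdd_ne_natAdd _ _)
  · exact absurd h (castAdd_ne_natAdd _ _)
  · rw [Fin.natAdd_injective _ _ (Fin.castAdd_injective _ _ h)]

/-- The pair of the embeddings of the first `a + b` elements and of the last `c` and the middle `b`
elements. -/
def standardPair : CoveringPair (a + b) (c + b) (a + b + c) :=
  ⟨(Fin.castAddEmb c, ⟨standardFun a b c, standardFun_injective a b c⟩), fun x => by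
    refine Fin.addCases (fun i => ?_) (fun i => ?_) x
    · exact Or.inl ⟨i, rfl⟩
    · exact Or.inr ⟨Fin.castAdd b i, standardFun_castAdd a b c i⟩⟩

theorem standardPair_fst (i : Fin (a + b)) : (standardPair a b c).1.1 i = Fin.castAdd c i := rfl

theorem standardPair_snd_castAdd (i : Fin c) :
    (standardPair a b c).1.2 (Fin.castAdd b i) = Fin.natAdd (a + b) i :=
  standardFun_castAdd a b c i

theorem standardPair_snd_natAdd (j : Fin b) :
    (standardPair a b c).1.2 (Fin.natAdd c j) = Fin.castAdd c (Fin.natAdd a j) :=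
  standardFun_natAdd a b c j

/-- The embedding of `S_a × S_b × S_c` into `S_{a+b+c} × S_{a+b} × S_{c+b}`. -/
def standardHom : Equiv.Perm (Fin a) × Equiv.Perm (Fin b) × Equiv.Perm (Fin c) →*
    Equiv.Perm (Fin (a + b + c)) × Equiv.Perm (Fin (a + b)) × Equiv.Perm (Fin (c + b)) where
  toFun x := (youngEmb rfl (youngEmb rfl (x.1, x.2.1), x.2.2), youngEmb rfl (x.1, x.2.1),
    youngEmb rfl (x.2.2, x.2.1))
  map_one' := by
    refine Prod.ext ?_ (Prod.ext ?_ ?_)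
    · change youngEmb rfl (youngEmb rfl 1, 1) = 1
      rw [map_one]
      exact map_one (youngEmb rfl)
    · exact map_one (youngEmb rfl)
    · exact map_one (youngEmb rfl)
  map_mul' x y := by
    have h : ∀ {p q : ℕ} (u u' : Equiv.Perm (Fin p)) (v v' : Equiv.Perm (Fin q)),
        youngEmb rfl (u * u', v * v') = youngEmb rfl (u, v) * youngEmb rfl (u', v') :=
      fun u u' v v' => map_mul (youngEmb rfl) (u, v) (u', v')
    simp only [Prod.fst_mul, Prod.snd_mul, h, Prod.mk_mul_mk]

theorem standardHom_injective : Function.Injective (standardHom a b c) := by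
  rintro ⟨u, v, w⟩ ⟨u', v', w'⟩ h
  have h1 := youngEmb_injective (congrArg (fun z => z.2.1) h)
  have h2 := youngEmb_injective (congrArg (fun z => z.2.2) h)
  simp only [Prod.mk.injEq] at h1 h2 ⊢
  exact ⟨h1.1, h1.2, h2.1⟩

/-- Compatibility with the first embedding makes `g` preserve the first `a + b` points and hence the
last `c`. Compatibility with the second makes it preserve the middle block, on which `r` and `s`
must then agree. -/
theorem smul_standardPair_iff
    (γ : Equiv.Perm (Fin (a + b + c)) × Equiv.Perm (Fin (a + b)) × Equiv.Perm (Fin (c + b))) :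
    γ • standardPair a b c = standardPair a b c ↔ γ ∈ Set.range (standardHom a b c) := by
  rw [CoveringPair.smul_eq_iff]
  constructor
  · obtain ⟨g, r, s⟩ := γ
    rintro ⟨h1, h2⟩
    simp only [standardPair_fst] at h1 h2
    obtain ⟨r', w, rfl⟩ := exists_youngEmb_eq g fun i => ⟨r i, h1 i⟩
    obtain rfl : r' = r := Equiv.ext fun i => by
      have := h1 i
      rw [youngEmb_castAdd] at this
      exact Fin.castAdd_injective _ _ this
    obtain ⟨w', v, rfl⟩ := exists_youngEmb_eq s fun i => ⟨w i, by
      apply (standardPair a b c).1.2.injective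
      rw [← h2, standardPair_snd_castAdd, standardPair_snd_castAdd, youngEmb_natAdd]⟩
    obtain rfl : w' = w := Equiv.ext fun i => by
      have := h2 (Fin.castAdd b i)
      rw [standardPair_snd_castAdd, youngEmb_natAdd, youngEmb_castAdd,
        standardPair_snd_castAdd] at this
      exact (Fin.natAdd_injective _ _ this).symm
    -- The middle block is seen by both embeddings, so `r'` maps it to itself through `v`;
    -- injectivity of `r'` then keeps the first `a` points among themselves.
    have h3 : ∀ j, r' (Fin.natAdd a j) = Fin.natAdd a (v j) := fun j => by
      have := h2 (Fin.natAdd c j)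
      rw [standardPair_snd_natAdd, youngEmb_castAdd, youngEmb_natAdd,
        standardPair_snd_natAdd] at this
      exact Fin.castAdd_injective _ _ this
    obtain ⟨u, v', rfl⟩ := exists_youngEmb_eq r' fun i => by
      induction h4 : r' (Fin.castAdd b i) using Fin.addCases with
      | left j => exact ⟨j, rfl⟩
      | right j =>
        have h5 := h3 (v.symm j)
        rw [Equiv.apply_symm_apply, ← h4] at h5
        exact absurd (r'.injective h5).symm (castAdd_ne_natAdd _ _)
    obtain rfl : v' = v := Equiv.ext fun j => by
      have := h3 j
      rw [youngEmb_natAdd] at this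
      exact Fin.natAdd_injective _ _ this
    exact ⟨(u, v', w'), rfl⟩
  · rintro ⟨⟨u, v, w⟩, rfl⟩
    refine ⟨fun i => ?_, fun j => ?_⟩
    · exact youngEmb_castAdd _ _ i
    · change youngEmb rfl (youngEmb rfl (u, v), w) _ = (standardPair a b c).1.2
        (youngEmb rfl (w, v) j)
      refine Fin.addCases (fun j => ?_) (fun j => ?_) j
      · rw [standardPair_snd_castAdd, youngEmb_natAdd, youngEmb_castAdd, standardPair_snd_castAdd]
      · rw [standardPair_snd_natAdd, youngEmb_castAdd, youngEmb_natAdd, youngEmb_natAdd,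
          standardPair_snd_natAdd]

end Standard

end

section

section Final

/-! ### Multiplicities as weighted counts of covering pairs -/

variable {𝕜 : Type*} [Field 𝕜] [CharZero 𝕜] {n m : ℕ}

theorem N_character_complIdem {k : ℕ} (h : m ≤ n) (hk : k ≤ n) (lam : k.Partition)
    (T : Finset (Fin m)) (g : Equiv.Perm (Fin m)) :
    (N 𝕜 hk lam).character (complIdem h T * groupElt h g) = avg fun r => chi 𝕜 lam r *
      (Nat.card {q : Fin k ↪ Fin m // (∀ i, g (q i) = q (r i)) ∧ ∀ i, q i ∉ T} : 𝕜) := by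
  rw [N_character]
  refine congrArg avg (funext fun r => ?_)
  rw [card_embedding_complIdem_mul_groupElt, mul_comm]

theorem trace_cellTest_N_eq_avg (h : m ≤ n) (nu : m.Partition) :
    LinearMap.trace 𝕜 _ ((N 𝕜 h nu).asAlgebraHom (cellTest h nu)) =
      avg fun g => avg fun r => chi 𝕜 nu g * chi 𝕜 nu r *
        (Nat.card {q : Fin m ↪ Fin m // (∀ i, g (q i) = q (r i)) ∧ ∀ j, j ∈ Set.range q} : 𝕜) := by
  rw [trace_cellTest]
  refine congrArg avg (funext fun g => ?_)
  simp only [N_character_complIdem, mul_avg, sum_avg]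
  refine congrArg avg (funext fun r => ?_)
  rw [← sum_neg_one_pow_mul_card_disjoint, Finset.mul_sum, Finset.mul_sum]
  refine Finset.sum_congr rfl fun T _ => ?_
  simp only [Set.forall_mem_range]
  ring

/-- Inclusion-exclusion leaves only bijections `q`, and each determines `r = q⁻¹ g q`, a conjugate
of `g`. The `m!` choices of `q` cancel the normalization of the average over `r`, leaving `⟨χ_ν,
χ_ν⟩`. -/
theorem trace_cellTest_N [IsAlgClosed 𝕜] (h : m ≤ n) (nu : m.Partition) :
    LinearMap.trace 𝕜 _ ((N 𝕜 h nu).asAlgebraHom (cellTest h nu)) = 1 := by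
  have h1 : ∀ g r : Equiv.Perm (Fin m),
      (Nat.card {q : Fin m ↪ Fin m // (∀ i, g (q i) = q (r i)) ∧ ∀ j, j ∈ Set.range q} : 𝕜) =
        ∑ q : Equiv.Perm (Fin m), if q⁻¹ * g * q = r then 1 else 0 := fun g r => by
    rw [Finset.sum_boole, ← Fintype.card_subtype, ← Nat.card_eq_fintype_card]
    congr 1
    have h2 : ∀ q : Equiv.Perm (Fin m), q⁻¹ * g * q = r ↔ ∀ i, g (q i) = q (r i) := fun q => by
      rw [mul_assoc, inv_mul_eq_iff_eq_mul]
      exact Equiv.ext_iff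
    exact Nat.card_congr
      { toFun := fun q => ⟨Equiv.ofBijective q.1 ⟨q.1.injective, q.2.2⟩, (h2 _).2 q.2.1⟩
        invFun := fun q => ⟨q.1.toEmbedding, (h2 q.1).1 q.2, q.1.surjective⟩
        left_inv := fun q => rfl
        right_inv := fun q => Subtype.ext (Equiv.ext fun i => rfl) }
  have h0 := chi_orthonormal (𝕜 := 𝕜) nu nu
  rw [if_pos rfl] at h0
  rw [trace_cellTest_N_eq_avg]
  refine Eq.trans ?_ h0
  refine congrArg avg (funext fun g => ?_)
  have h2 : ∀ r : Equiv.Perm (Fin m), chi 𝕜 nu g * chi 𝕜 nu r * (∑ q : Equiv.Perm (Fin m),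
      if q⁻¹ * g * q = r then (1 : 𝕜) else 0) =
      ∑ q : Equiv.Perm (Fin m), if q⁻¹ * g * q = r then chi 𝕜 nu g * chi 𝕜 nu r else 0 :=
    fun r => by
    rw [Finset.mul_sum]
    exact Finset.sum_congr rfl fun q _ => by rw [mul_ite, mul_one, mul_zero]
  simp only [h1, h2]
  rw [avg, Finset.sum_comm]
  have h3 : ∀ q : Equiv.Perm (Fin m),
      (∑ r, if q⁻¹ * g * q = r then chi 𝕜 nu g * chi 𝕜 nu r else 0) =
        chi 𝕜 nu g * chi 𝕜 nu g := fun q => by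
    rw [Finset.sum_ite_eq, if_pos (Finset.mem_univ _)]
    congr 1
    have := isClassFun_chi (𝕜 := 𝕜) nu g q⁻¹
    rwa [inv_inv] at this
  rw [Finset.sum_congr rfl fun q _ => h3 q]
  exact avg_const (G := Equiv.Perm (Fin m)) _

variable [IsAlgClosed 𝕜]

/-- An endomorphism of the zero space cannot have trace one. -/
theorem nontrivial_NV (h : m ≤ n) (nu : m.Partition) : Nontrivial (NV 𝕜 h nu) := by
  by_contra hN
  rw [not_nontrivial_iff_subsingleton] at hN
  have h1 := trace_cellTest_N (𝕜 := 𝕜) h nu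
  have h2 : (N 𝕜 h nu).asAlgebraHom (cellTest h nu) = 0 :=
    LinearMap.ext fun _ => Subsingleton.elim _ _
  rw [h2, map_zero] at h1
  exact zero_ne_one h1

theorem isKroneckerCoeff_eq_trace {k l : ℕ} (hk : k ≤ n) (hl : l ≤ n) (hm : m ≤ n)
    (lam : k.Partition) (mu : l.Partition) (nu : m.Partition) :
    (isKroneckerCoeff 𝕜 hk hl hm lam mu nu : 𝕜) =
      LinearMap.trace 𝕜 _ (((N 𝕜 hk lam).tprod (N 𝕜 hl mu)).asAlgebraHom (cellTest hm nu)) := by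
  have := nontrivial_NV (𝕜 := 𝕜) hm nu
  exact multiplicity_eq_trace _ _ _ (trace_cellTest_N hm nu) fun S _ _ _ τ hτ he =>
    trace_cellTest_eq_zero hm nu τ hτ he

/-- The character of the tensor product counts pairs of embeddings that avoid `T` and are compatible
with `(g, r, s)`. The alternating sum over `T` retains the pairs that cover all `m` points, and
compatibility means being fixed by `(g, r, s)`. -/
theorem isKroneckerCoeff_eq_avg {k l : ℕ} (hk : k ≤ n) (hl : l ≤ n) (hm : m ≤ n)
    (lam : k.Partition) (mu : l.Partition) (nu : m.Partition) :
    (isKroneckerCoeff 𝕜 hk hl hm lam mu nu : 𝕜) =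
      avg fun γ : Equiv.Perm (Fin m) × Equiv.Perm (Fin k) × Equiv.Perm (Fin l) =>
        (chi 𝕜 nu γ.1 * (chi 𝕜 lam γ.2.1 * chi 𝕜 mu γ.2.2)) *
          (Nat.card {z : CoveringPair k l m // γ • z = z} : 𝕜) := by
  rw [isKroneckerCoeff_eq_trace, trace_cellTest, avg_prod]
  refine congrArg avg (funext fun g => ?_)
  rw [avg_prod]
  simp only [Representation.char_tensor, Pi.mul_apply, N_character_complIdem, avg_mul, mul_avg,
    sum_avg, Finset.mul_sum]
  rw [avg_comm]
  refine congrArg avg (funext fun r => congrArg avg (funext fun s => ?_))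
  have h1 : (Nat.card {z : CoveringPair k l m // (g, r, s) • z = z} : 𝕜) =
      Nat.card {z : (Fin k ↪ Fin m) × (Fin l ↪ Fin m) //
        ((∀ i, g (z.1 i) = z.1 (r i)) ∧ ∀ j, g (z.2 j) = z.2 (s j)) ∧
          ∀ x, x ∈ Set.range z.1 ∨ x ∈ Set.range z.2} := by
    congr 1
    exact Nat.card_congr
      { toFun := fun z => ⟨z.1.1, (CoveringPair.smul_eq_iff _ _ _).1 z.2, z.1.2⟩
        invFun := fun z => ⟨⟨z.1, z.2.2⟩, (CoveringPair.smul_eq_iff _ _ _).2 z.2.1⟩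
        left_inv := fun _ => rfl
        right_inv := fun _ => rfl }
  rw [h1, ← sum_neg_one_pow_mul_card_disjoint, Finset.mul_sum]
  refine Finset.sum_congr rfl fun T _ => ?_
  have h2 : Nat.card {z : (Fin k ↪ Fin m) × (Fin l ↪ Fin m) //
        ((∀ i, g (z.1 i) = z.1 (r i)) ∧ ∀ j, g (z.2 j) = z.2 (s j)) ∧
          ∀ x, x ∈ Set.range z.1 ∨ x ∈ Set.range z.2 → x ∉ T} =
      Nat.card {q : Fin k ↪ Fin m // (∀ i, g (q i) = q (r i)) ∧ ∀ i, q i ∉ T} *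
      Nat.card {q : Fin l ↪ Fin m // (∀ i, g (q i) = q (s i)) ∧ ∀ i, q i ∉ T} := by
    rw [← Nat.card_prod]
    refine Nat.card_congr ((Equiv.subtypeEquivRight fun z => ?_).trans
      Equiv.subtypeProdEquivProd)
    simp only [or_imp, forall_and, Set.forall_mem_range]
    tauto
  rw [h2, Nat.cast_mul]
  ring

theorem isKroneckerCoeff_eq_zero {k l : ℕ} (hk : k ≤ n) (hl : l ≤ n) (hm : m ≤ n)
    (lam : k.Partition) (mu : l.Partition) (nu : m.Partition) (h : m < max k l ∨ k + l < m) :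
    isKroneckerCoeff 𝕜 hk hl hm lam mu nu = 0 := by
  have hE : IsEmpty (CoveringPair k l m) := ⟨fun z => by
    have h1 := z.max_le
    have h2 := z.le_add
    omega⟩
  refine Nat.cast_injective (R := 𝕜) ?_
  rw [isKroneckerCoeff_eq_avg, Nat.cast_zero]
  simp [avg]

theorem isKroneckerCoeff_eq_sum {a b c k l : ℕ} (hk : k ≤ n) (hl : l ≤ n) (hm : m ≤ n)
    (h₁ : a + b = k) (h₂ : c + b = l) (h₃ : a + b + c = m)
    (lam : k.Partition) (mu : l.Partition) (nu : m.Partition) :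
    isKroneckerCoeff 𝕜 hk hl hm lam mu nu =
      ∑ α : a.Partition, ∑ β : b.Partition, ∑ γ : c.Partition, ∑ δ : b.Partition,
        ∑ ε : b.Partition, ∑ κ : (a + b).Partition,
          lrCoeff 𝕜 h₁ α β lam * lrCoeff 𝕜 h₂ γ δ mu * kroneckerCoeff 𝕜 β δ ε *
          lrCoeff 𝕜 (rfl : a + b = a + b) α ε κ * lrCoeff 𝕜 h₃ κ γ nu := by
  refine Nat.cast_injective (R := 𝕜) ?_
  rw [sum_coeffs_eq_avg, isKroneckerCoeff_eq_avg]
  subst h₁ h₂ h₃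
  rw [avg_mul_card_fixedBy (f := fun γ : Equiv.Perm (Fin (a + b + c)) × Equiv.Perm (Fin (a + b)) ×
    Equiv.Perm (Fin (c + b)) => chi 𝕜 nu γ.1 * (chi 𝕜 lam γ.2.1 * chi 𝕜 mu γ.2.2))
    (standardPair a b c) (standardHom a b c)
    (standardHom_injective a b c) (smul_standardPair_iff a b c) fun g x => ?_, avg_prod]
  · refine congrArg avg (funext fun u => ?_)
    rw [avg_prod]
    refine congrArg avg (funext fun v => congrArg avg (funext fun w => ?_))
    rw [mul_comm]
    rfl
  · exact congrArg₂ _ (isClassFun_chi nu _ _)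
      (congrArg₂ _ (isClassFun_chi lam _ _) (isClassFun_chi mu _ _))

end Final

end

end ISKron

end

theorem theorem1 (𝕜 : Type*) [Field 𝕜] [IsAlgClosed 𝕜] [CharZero 𝕜] (n k l m : ℕ)
    (hk : k ≤ n) (hl : l ≤ n) (hm : m ≤ n)
    (lam : k.Partition) (mu : l.Partition) (nu : m.Partition) :
    (m < max k l ∨ k + l < m → ISKron.isKroneckerCoeff 𝕜 hk hl hm lam mu nu = 0) ∧
    (∀ (h₁ : max k l ≤ m) (h₂ : m ≤ k + l) (a b c : ℕ)
      (hb : b = k + l - m) (ha : a = k - b) (hc : c = l - b),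
      ISKron.isKroneckerCoeff 𝕜 hk hl hm lam mu nu =
        ∑ α : a.Partition, ∑ β : b.Partition, ∑ γ : c.Partition, ∑ δ : b.Partition,
          ∑ ε : b.Partition, ∑ κ : (a + b).Partition,
            ISKron.lrCoeff 𝕜 (show a + b = k by omega) α β lam *
            ISKron.lrCoeff 𝕜 (show c + b = l by omega) γ δ mu *
            ISKron.kroneckerCoeff 𝕜 β δ ε *
            ISKron.lrCoeff 𝕜 (show a + b = a + b from rfl) α ε κ *
            ISKron.lrCoeff 𝕜 (show a + b + c = m by omega) κ γ nu) := by
  refine ⟨ISKron.isKroneckerCoeff_eq_zero hk hl hm lam mu nu, ?_⟩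
  intro h₁ h₂ a b c hb ha hc
  exact ISKron.isKroneckerCoeff_eq_sum hk hl hm (by omega) (by omega) (by omega) lam mu nu
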